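/- **Setting.** Let $d\in\{2,3\}$ and let $\Omega\subset\mathbb R^d$ be a bounded connected domain with a finite partition $\mathcal T_h$ into closed convex polytopes (e.g. simplices or boxes) without hanging nodes: any two elements meet in a common face or not at all, $\overline\Omega=\bigcup_{K\in\mathcal T_h} K$, and $\Omega$ is the interior of this union. Let $\mathcal F_h$ be the set of facets, $\mathcal F_h^i$ the facets shared by two elements $K^+\neq K^-$, and $n_F$ the unit normal of $F$ pointing out of $K^+$ (out of $\Omega$ on boundary facets). Write $[\![\phi]\!]=\phi^+-\phi^-$ and $\{\!\{\phi\}\!\}=\frac12(\phi^++\phi^-)$ on $F\in\mathcal F_h^i$, and $[\![\phi]\!]=\{\!\{\phi\}\!\}=\phi$ on boundary facets. Given $\kappa>0$ and $N\in\mathbb N$, the mesh with facet lengths $(h_F)_F$ is called $(\kappa,N)$-shape-regular if every element $K$, of diameter $h_K$, contains a closed ball of radius $h_K/\kappa$ and has at most $N$ facets, and $h_K/\kappa\le h_F\le\kappa h_K$ for every facet $F$ of $K$. For each $K$ let $V(K)$ and $Q(K)$ be linear spaces of vector-valued and scalar polynomials, respectively, of total degree at most $m$, and put $$V_h=\{v\in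 H(\mathrm{div};\Omega): v|_K\in V(K)\ \forall K,\ v\cdot n|_{\partial\Omega}=0\},\qquad Q_h=\{q\in L^2_0(\Omega): q|_K\in Q(K)\ \forall K\},$$ $b(w,q)=-\int_\Omega q\,\nabla\cdot w$ and $V_h^{\mathrm{div}}=\{v\in V_h: b(v,q)=0\ \forall q\in Q_h\}$. With the elementwise gradient $\nabla_h$, $(\nabla w)_{ij}=\partial w_i/\partial x_j$, let $$a_h(w,v)=\int_\Omega\nabla_hw:\nabla_hv-\sum_{F\in\mathcal F_h}\int_F\{\!\{\nabla w\}\!\}n_F\cdot[\![v]\!]-\sum_{F\in\mathcal F_h}\int_F[\![w]\!]\cdot\{\!\{\nabla v\}\!\}n_F+\sum_{F\in\mathcal F_h}\int_F\frac{\sigma}{h_F}[\![w]\!]\cdot[\![v]\!],$$ $$\|w\|_e^2=\|\nabla_hw\|_{L^2}^2+\sum_{F\in\mathcal F_h}\frac{\sigma}{h_F}\|[\![w]\!]\|_{L^2(F)}^2,$$ $$c_h(\beta;w,v)=\int_\Omega(\beta\cdot\nabla_h)w\cdot v-\sum_{F\in\mathcal F_h^i}\int_F(\beta\cdot n_F)[\![w]\!]\cdot\{\!\{v\}\!\}+\sum_{F\in\mathcal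 F_h^i}\int_F\frac\gamma2|\beta\cdot n_F|\,[\![w]\!]\cdot[\![v]\!],$$ $$|w|_{\beta,\mathrm{upw}}^2=\sum_{F\in\mathcal F_h^i}\int_F\frac\gamma2|\beta\cdot n_F|\,|[\![w]\!]|^2.$$ Here $T>0$, $\nu>0$, $\gamma\ge0$, and $\beta\in L^\infty((0,T)\times\Omega)^d$ satisfies, for almost every $t$, $\nabla\cdot\beta(t)=0$ weakly in $\Omega$ and $\beta(t)\cdot n=0$ on $\partial\Omega$; its normal traces $\beta\cdot n_F\in L^\infty((0,T)\times F)$ are understood through Green's formula on the elements. For $r\in\{1,2\}$, a solution of class $r$ of the semi-discrete problem with initial value $u_{0h}$ is a pair $(u_h,p_h)$ with $u_h\in W^{1,r}(0,T;V_h)$ (continuous representative), $p_h\in L^r(0,T;Q_h)$, $u_h(0)=u_{0h}$ and, for almost every $t\in(0,T)$ and all $(v,q)\in V_h\times Q_h$, $$(\partial_tu_h,v)+\nu a_h(u_h,v)+c_h(\beta;u_h,v)+b(v,p_h)-b(u_h,q)=(f,v).$$ **Lemma 2.11 (Well-posedness and velocity energy estimate).** For all $d\in\{2,3\}$, $m,N\in\mathbb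 N$ and $\kappa>0$ there is $\sigma_0>0$ such that for every $\sigma\ge\sigma_0$ there is $C_\sigma>0$, depending only on $d,m,N,\kappa,\sigma$ (in particular independent of $h$), such that in the above setting on every $(\kappa,N)$-shape-regular mesh the coercivity $a_h(v,v)\ge C_\sigma\|v\|_e^2$ holds for all $v\in V_h$, and the following is true for all $T,\nu,\gamma,\beta$ as above. Let $f\in L^1(0,T;L^2(\Omega)^d)$ and $u_{0h}\in V_h^{\mathrm{div}}$. Then there is a solution $(u_h,p_h)$ of class $1$, of class $2$ if moreover $f\in L^2(0,T;L^2(\Omega)^d)$, such that $\nu C_\sigma\|u_h\|_e^2+|u_h|^2_{\beta,\mathrm{upw}}$ is integrable on $(0,T)$ and, for every $t\in[0,T]$, $$\frac12\|u_h(t)\|_{L^2}^2+\int_0^t\Big[\nu C_\sigma\|u_h\|_e^2+|u_h|_{\beta,\mathrm{upw}}^2\Big]\,d\tau\le\|u_{0h}\|_{L^2}^2+\frac32\|f\|_{L^1(0,T;L^2)}^2 .$$ If $f$ is even Lipschitz in time, i.e. Lipschitz from $(0,T]$ to $L^2(\Omega)^d$, then the velocity is unique: the velocities of any two solutions of class $1$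 with the same data agree on $[0,T]$. -/

import Mathlib

open MeasureTheory Set
open scoped RealInnerProductSpace ENNReal ContDiff Gradient

namespace HdivFEM

noncomputable section

/-- Euclidean space `ℝ^d`. -/
abbrev Vec (d : ℕ) : Type := EuclideanSpace ℝ (Fin d)

/-- `F` is a facet of the polytope `K`: a face of dimension `d - 1`. -/
def IsFacet {d : ℕ} (K F : Set (Vec d)) : Prop :=
  IsExposed ℝ K F ∧ F.Nonempty ∧ Module.finrank ℝ (vectorSpan ℝ F) + 1 = d

/-- A finite element partition without hanging nodes of a bounded connected domain `Ω` into convex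
polytopes (for instance simplices or boxes), together with its skeleton and an orientation of the
facets. -/
structure Mesh (d : ℕ) where
  /-- the domain -/
  Ω : Set (Vec d)
  isOpen : IsOpen Ω
  isConnected : IsConnected Ω
  isBounded : Bornology.IsBounded Ω
  /-- the (closed) elements -/
  elems : Finset (Set (Vec d))
  polytope : ∀ K ∈ elems, ∃ s : Finset (Vec d), K = convexHull ℝ (s : Set (Vec d))
  interior_nonempty : ∀ K ∈ elems, (interior K).Nonempty
  interior_disjoint : ∀ K ∈ elems, ∀ K' ∈ elems, K ≠ K' → Disjoint (interior K) (interior K')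
  closure_eq : closure Ω = ⋃ K ∈ elems, K
  domain_eq : Ω = interior (⋃ K ∈ elems, K)
  /-- no hanging nodes: two elements meet in a common face (or not at all) -/
  conforming : ∀ K ∈ elems, ∀ K' ∈ elems, IsExposed ℝ K (K ∩ K')
  /-- the skeleton, i.e. the set of all facets of all elements -/
  facets : Finset (Set (Vec d))
  mem_facets : ∀ F, F ∈ facets ↔ ∃ K ∈ elems, IsFacet K F
  /-- the element `K⁺` adjacent to a facet -/
  pos : facets → elems
  /-- the element `K⁻` adjacent to a facet; equal to `K⁺` if there is only one adjacent element -/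
  neg : facets → elems
  pos_facet : ∀ F, IsFacet (pos F).1 F.1
  neg_facet : ∀ F, IsFacet (neg F).1 F.1
  adjacent : ∀ (F : facets) (K : elems), IsFacet K.1 F.1 → K = pos F ∨ K = neg F
  /-- the unit normal `n_F`; it points out of `K⁺`, hence out of `Ω` on boundary facets -/
  normal : facets → Vec d
  norm_normal : ∀ F, ‖normal F‖ = 1
  normal_outer : ∀ F, ∀ y ∈ F.1, ∀ x ∈ (pos F).1, ⟪normal F, x - y⟫ ≤ 0

variable {d : ℕ} (M : Mesh d)

/-- Interior facets are those shared by two different elements; all the others lie on `∂Ω`. -/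
def Mesh.IsInterior (F : M.facets) : Prop := M.pos F ≠ M.neg F

/-- Shape regularity with constants `κ`, `N`: every element `K`, with diameter `h_K`, contains a
ball of radius `h_K / κ` and has at most `N` facets, and the facet lengths `h_F` are comparable to
the diameters of the adjacent elements. -/
def ShapeRegular (κ : ℝ) (N : ℕ) (hF : M.facets → ℝ) : Prop :=
  (∀ K ∈ M.elems, ∃ x, Metric.closedBall x (Metric.diam K / κ) ⊆ K) ∧
  (∀ K ∈ M.elems, {F : Set (Vec d) | F ∈ M.facets ∧ IsFacet K F}.ncard ≤ N) ∧
  (∀ (F : M.facets) (K : M.elems), IsFacet K.1 F.1 →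
    Metric.diam K.1 / κ ≤ hF F ∧ hF F ≤ κ * Metric.diam K.1)

/-! ### Broken polynomial functions -/

/-- Polynomial vector fields on `ℝ^d`. -/
abbrev PolyField (d : ℕ) : Type := Fin d → MvPolynomial (Fin d) ℝ

/-- Elementwise polynomial vector fields; since an element has interior points, the polynomial on
each element is the same thing as its restriction to the element. -/
abbrev BrokenField : Type := M.elems → PolyField d

/-- Elementwise polynomial scalar functions. -/
abbrev BrokenScalar : Type := M.elems → MvPolynomial (Fin d) ℝ

/-- Value of a polynomial at a point. -/
def peval (p : MvPolynomial (Fin d) ℝ) (x : Vec d) : ℝ := MvPolynomial.eval (fun i => x i) p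

/-- Value of a polynomial field at a point. -/
def val (v : PolyField d) (x : Vec d) : Vec d := WithLp.toLp 2 fun i => peval (v i) x

/-- Jacobian matrix `(∂ v_i / ∂ x_j)`. -/
def jac (v : PolyField d) (x : Vec d) : Matrix (Fin d) (Fin d) ℝ :=
  fun i j => peval (MvPolynomial.pderiv j (v i)) x

/-- `(∇v) b = (b · ∇) v` at the point `x`. -/
def dirDeriv (v : PolyField d) (b x : Vec d) : Vec d :=
  WithLp.toLp 2 ((jac v x).mulVec fun j => b j)

/-- Divergence of a polynomial field. -/
def divg (v : PolyField d) (x : Vec d) : ℝ := ∑ i, jac v x i i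

/-- The function on `Ω` (defined up to a null set) glued from functions on the elements. -/
def glue {G : Type*} [AddCommMonoid G] (g : M.elems → Vec d → G) (x : Vec d) : G :=
  ∑ K, (interior K.1).indicator (g K) x

theorem continuous_peval (p : MvPolynomial (Fin d) ℝ) : Continuous (peval p) :=
  (MvPolynomial.continuous_eval p).comp
    (continuous_pi fun i => (continuous_apply i).comp (PiLp.continuous_ofLp 2 _))

theorem continuous_val (v : PolyField d) : Continuous (val v) :=
  (PiLp.continuous_toLp 2 _).comp (continuous_pi fun i => continuous_peval (v i))

theorem memLp_glue {G : Type*} [NormedAddCommGroup G] [SecondCountableTopology G]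
    (g : M.elems → Vec d → G) (hg : ∀ K, Continuous (g K)) :
    MemLp (glue M g) 2 (volume.restrict M.Ω) := by
  have key : ∀ K : M.elems,
      MemLp ((interior K.1).indicator (g K)) 2 (volume.restrict M.Ω) := by
    intro K
    obtain ⟨s, hs⟩ := M.polytope K.1 K.2
    have hc : IsCompact K.1 := by
      rw [hs]; exact s.finite_toSet.isCompact_convexHull (𝕜 := ℝ)
    obtain ⟨C, hC⟩ := hc.exists_bound_of_continuousOn (hg K).continuousOn
    have : IsFiniteMeasure (volume.restrict M.Ω) :=
      ⟨by simpa using M.isBounded.measure_lt_top⟩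
    refine MemLp.of_bound (C := max C 0)
      (((hg K).aestronglyMeasurable).indicator isOpen_interior.measurableSet) ?_
    refine Filter.Eventually.of_forall fun x => ?_
    by_cases hx : x ∈ interior K.1
    · rw [indicator_of_mem hx]
      exact (hC x (interior_subset hx)).trans (le_max_left _ _)
    · rw [indicator_of_notMem hx]
      simp
  exact memLp_finsetSum Finset.univ fun K _ => key K

/-- `L²(Ω)^d`. -/
abbrev L2Vec : Type := Lp (Vec d) 2 (volume.restrict M.Ω)

/-- `L²(Ω)`. -/
abbrev L2Scal : Type := Lp ℝ 2 (volume.restrict M.Ω)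

/-- A broken polynomial field as an element of `L²(Ω)^d`. -/
def toL2 (v : BrokenField M) : L2Vec M :=
  (memLp_glue M (fun K => val (v K)) fun K => continuous_val (v K)).toLp _

/-- A broken polynomial as an element of `L²(Ω)`. -/
def toL2s (q : BrokenScalar M) : L2Scal M :=
  (memLp_glue M (fun K => peval (q K)) fun K => continuous_peval (q K)).toLp _

/-! ### The discrete spaces -/

/-- `g` is the weak divergence of `w` in `Ω`. -/
def HasWeakDiv (Ω : Set (Vec d)) (w : Vec d → Vec d) (g : Vec d → ℝ) : Prop :=
  ∀ φ : Vec d → ℝ, ContDiff ℝ ∞ φ → HasCompactSupport φ → tsupport φ ⊆ Ω →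
    ∫ x in Ω, ⟪w x, ∇ φ x⟫ = -∫ x in Ω, g x * φ x

/-- The space `H(div; Ω)`. -/
def MemHdiv (Ω : Set (Vec d)) (w : Vec d → Vec d) : Prop :=
  MemLp w 2 (volume.restrict Ω) ∧
    ∃ g : Vec d → ℝ, MemLp g 2 (volume.restrict Ω) ∧ HasWeakDiv Ω w g

/-- The velocity space `V_h`: `H(div)`-conforming, elementwise in the local space, and with
vanishing normal trace on `∂Ω`. -/
def Vh (Vloc : M.elems → Submodule ℝ (PolyField d)) : Set (BrokenField M) :=
  {v | (∀ K, v K ∈ Vloc K) ∧ MemHdiv M.Ω (glue M fun K => val (v K)) ∧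
    ∀ F : M.facets, ¬ M.IsInterior F → ∀ x ∈ F.1, ⟪val (v (M.pos F)) x, M.normal F⟫ = 0}

/-- The pressure space `Q_h`: elementwise in the local space, with zero mean. -/
def Qh (Qloc : M.elems → Submodule ℝ (MvPolynomial (Fin d) ℝ)) : Set (BrokenScalar M) :=
  {q | (∀ K, q K ∈ Qloc K) ∧ ∑ K, ∫ x in K.1, peval (q K) x = 0}

/-- The pressure-velocity coupling `b(w, q) = -∫_Ω q ∇·w`. For `w ∈ H(div; Ω)` the weak divergence
coincides almost everywhere with the divergence taken on each element. -/
def bForm (w : BrokenField M) (q : BrokenScalar M) : ℝ :=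
  -∑ K, ∫ x in K.1, peval (q K) x * divg (w K) x

/-- Discretely divergence-free velocities. -/
def VhDiv (Vloc : M.elems → Submodule ℝ (PolyField d))
    (Qloc : M.elems → Submodule ℝ (MvPolynomial (Fin d) ℝ)) : Set (BrokenField M) :=
  {v | v ∈ Vh M Vloc ∧ ∀ q ∈ Qh M Qloc, bForm M v q = 0}

/-! ### Jumps, averages and the discrete forms -/

open Classical in
/-- Jump `φ⁺ - φ⁻` across an interior facet, and the trace itself on a boundary facet, of a function
given on each element. -/
def jump {G : Type*} [AddCommGroup G] (g : M.elems → Vec d → G) (F : M.facets) (x : Vec d) : G :=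
  if M.IsInterior F then g (M.pos F) x - g (M.neg F) x else g (M.pos F) x

open Classical in
/-- Average `(φ⁺ + φ⁻) / 2` on an interior facet, and the trace itself on a boundary facet. -/
def avg {G : Type*} [AddCommGroup G] [Module ℝ G] (g : M.elems → Vec d → G) (F : M.facets)
    (x : Vec d) : G :=
  if M.IsInterior F then (1 / 2 : ℝ) • (g (M.pos F) x + g (M.neg F) x) else g (M.pos F) x

/-- Surface measure on a facet. -/
def facetMeasure (F : M.facets) : Measure (Vec d) :=
  (Measure.euclideanHausdorffMeasure (d - 1)).restrict F.1

/-- Jump of a discrete velocity. -/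
def vjump (v : BrokenField M) (F : M.facets) (x : Vec d) : Vec d :=
  jump M (fun K => val (v K)) F x

/-- `{{∇v}} n_F`. -/
def gradNormalAvg (v : BrokenField M) (F : M.facets) (x : Vec d) : Vec d :=
  avg M (fun K y => dirDeriv (v K) (M.normal F) y) F x

/-- The symmetric interior penalty form `a_h`. -/
def aForm (σ : ℝ) (hF : M.facets → ℝ) (w v : BrokenField M) : ℝ :=
  (∑ K, ∫ x in K.1, ∑ i, ∑ j, jac (w K) x i j * jac (v K) x i j)
    - (∑ F, ∫ x, ⟪gradNormalAvg M w F x, vjump M v F x⟫ ∂(facetMeasure M F))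
    - (∑ F, ∫ x, ⟪vjump M w F x, gradNormalAvg M v F x⟫ ∂(facetMeasure M F))
    + ∑ F, ∫ x, σ / hF F * ⟪vjump M w F x, vjump M v F x⟫ ∂(facetMeasure M F)

/-- The square of the discrete energy norm `‖·‖_e`. -/
def energySq (σ : ℝ) (hF : M.facets → ℝ) (w : BrokenField M) : ℝ :=
  (∑ K, ∫ x in K.1, ∑ i, ∑ j, jac (w K) x i j ^ 2)
    + ∑ F, σ / hF F * ∫ x, ‖vjump M w F x‖ ^ 2 ∂(facetMeasure M F)

open Classical in
/-- The upwind convection form `c_h(β; w, v)`; `βn F` stands for the normal trace `β · n_F`. -/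
def cForm (γ : ℝ) (β : Vec d → Vec d) (βn : M.facets → Vec d → ℝ) (w v : BrokenField M) : ℝ :=
  (∑ K, ∫ x in K.1, ⟪dirDeriv (w K) (β x) x, val (v K) x⟫)
    - (∑ F with M.IsInterior F, ∫ x, βn F x *
        ⟪vjump M w F x, avg M (fun K => val (v K)) F x⟫ ∂(facetMeasure M F))
    + ∑ F with M.IsInterior F, ∫ x, γ / 2 * |βn F x| *
        ⟪vjump M w F x, vjump M v F x⟫ ∂(facetMeasure M F)

open Classical in
/-- The square of the upwind seminorm. -/
def upwSq (γ : ℝ) (βn : M.facets → Vec d → ℝ) (w : BrokenField M) : ℝ :=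
  ∑ F with M.IsInterior F,
    ∫ x, γ / 2 * |βn F x| * ‖vjump M w F x‖ ^ 2 ∂(facetMeasure M F)

/-! ### The convective velocity -/

open Classical in
/-- `βn` is the family of normal traces `β · n_F` on the facets of a bounded divergence-free field
`β`, in the sense of Green's formula
`∫_K β · ∇φ = ∫_{∂K} (β · n_K) φ`, where `n_K = n_F` if `K = K⁺` and `n_K = -n_F` if `K = K⁻`.
This determines `βn` almost everywhere on each facet; if `β` is smooth up to the facets, then
`βn F x = ⟪β x, n_F⟫`. -/
def IsNormalTrace (β : Vec d → Vec d) (βn : M.facets → Vec d → ℝ) : Prop :=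
  ∀ (K : M.elems) (φ : Vec d → ℝ), ContDiff ℝ ∞ φ →
    ∫ x in K.1, ⟪β x, ∇ φ x⟫ =
      ∑ F : M.facets,
        if K = M.pos F then ∫ x, βn F x * φ x ∂(facetMeasure M F)
        else if K = M.neg F then -∫ x, βn F x * φ x ∂(facetMeasure M F)
        else 0

/-- The convective velocity: `β ∈ L^∞(0,T;L^∞)` with normal traces `βn`, and, for almost every
time, `∇·β = 0` in `Ω` and `β · n = 0` on `∂Ω`. -/
def IsConvectiveField (T : ℝ) (β : ℝ → Vec d → Vec d) (βn : ℝ → M.facets → Vec d → ℝ) : Prop :=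
  MemLp (fun z : ℝ × Vec d => β z.1 z.2) ∞
    ((volume.restrict (Ioc 0 T)).prod (volume.restrict M.Ω)) ∧
  (∀ F, MemLp (fun z : ℝ × Vec d => βn z.1 F z.2) ∞
    ((volume.restrict (Ioc 0 T)).prod (facetMeasure M F))) ∧
  ∀ᵐ t ∂(volume.restrict (Ioc 0 T)),
    HasWeakDiv M.Ω (β t) (fun _ => 0) ∧ IsNormalTrace M (β t) (βn t) ∧
    ∀ F, ¬ M.IsInterior F → ∀ᵐ x ∂(facetMeasure M F), βn t F x = 0

/-! ### The semi-discrete problem -/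

/-- `(u, p)` solves the semi-discrete problem on `[0, T]` with initial value `u₀`, and
`u ∈ W^{1,r}(0,T;V_h)` (represented by its continuous version), `p ∈ L^r(0,T;Q_h)`. The field `u'`
is the time derivative of `u`. For `r = 2` this is the solution space `V_h^T × Q_h^T`. -/
def IsSolution (Vloc : M.elems → Submodule ℝ (PolyField d))
    (Qloc : M.elems → Submodule ℝ (MvPolynomial (Fin d) ℝ))
    (hF : M.facets → ℝ) (σ γ ν T : ℝ) (β : ℝ → Vec d → Vec d)
    (βn : ℝ → M.facets → Vec d → ℝ) (f : ℝ → L2Vec M) (u₀ : BrokenField M) (r : ℝ≥0∞)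
    (u : ℝ → BrokenField M) (p : ℝ → BrokenScalar M) : Prop :=
  u 0 = u₀ ∧
  (∀ t ∈ Icc 0 T, u t ∈ Vh M Vloc) ∧
  MemLp (fun t => toL2 M (u t)) r (volume.restrict (Ioc 0 T)) ∧
  (∀ᵐ t ∂(volume.restrict (Ioc 0 T)), p t ∈ Qh M Qloc) ∧
  MemLp (fun t => toL2s M (p t)) r (volume.restrict (Ioc 0 T)) ∧
  ∃ u' : ℝ → BrokenField M,
    (∀ᵐ t ∂(volume.restrict (Ioc 0 T)), u' t ∈ Vh M Vloc) ∧
    MemLp (fun t => toL2 M (u' t)) r (volume.restrict (Ioc 0 T)) ∧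
    (∀ t ∈ Icc 0 T, toL2 M (u t) = toL2 M (u 0) + ∫ s in (0 : ℝ)..t, toL2 M (u' s)) ∧
    ∀ᵐ t ∂(volume.restrict (Ioc 0 T)), ∀ v ∈ Vh M Vloc, ∀ q ∈ Qh M Qloc,
      ⟪toL2 M (u' t), toL2 M v⟫ + ν * aForm M σ hF (u t) v + cForm M γ (β t) (βn t) (u t) v
        + bForm M v (p t) - bForm M (u t) q = ⟪f t, toL2 M v⟫

end

end HdivFEM

open HdivFEM

/-! The time-independent ingredient is coercivity (`exists_aForm_coercive`). A facet of a convex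
element lies in a supporting hyperplane, and the cone over it with apex at the centre of the
inscribed ball is contained in the element. Fubini along the height of the cone
(`integral_cone_le`), together with the equivalence of norms on polynomials of bounded degree in one
variable (`exists_eval_one_sq_le`), gives a discrete trace inequality whose constant depends only on
the dimension and the degree (`exists_trace_constant`). Shape regularity turns it into a bound of
the averaged normal derivatives by the elementwise gradient (`exists_sum_gradNormalAvg_le`), and
Young's inequality absorbs the two consistency terms into the gradient and the penalty, with
coercivity constant `1 / 2`.

The convection form is skew up to upwinding: `c_h(β; v, v) = |v|²_upw` (`cForm_self`). Green's
formula for `β` is tested on each element with the polynomial `|v|² / 2`, and the facet terms that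
appear are those of the form because `[[v]] · {{v}} = [[|v|²]] / 2`.

On the kernel of `b` the problem is a linear system of ordinary differential equations with bounded
measurable coefficients and integrable right-hand side, solved by Picard iteration in an
exponentially weighted norm (`exists_caratheodory_solution`). The residual vanishes on the kernel,
hence is represented by a pressure; the representation can be chosen linear in the residual
(`exists_linear_multiplier`), which makes the pressure as integrable in time as the data
(`exists_galerkin_solution`). No inf-sup condition is needed, since no bound on the pressure is
claimed and the pressure need not be unique.

Testing with the velocity gives `⟪∂ₜu, u⟫ ≤ ‖f‖ ‖u‖ - D` with the dissipation
`D = ν C ‖u‖_e² + |u|²_upw`. A Gronwall argument for `‖u‖` itself rather than for its square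
(`norm_primitive_le`) yields `‖u(t)‖ ≤ ‖u₀‖ + ∫ ‖f‖`, and inserting this into the integrated energy
identity gives the constants `1` and `3 / 2` (`energy_estimate`). The difference of two solutions
satisfies the same inequality with `f = 0`, so the velocity is unique
(`IsSolution.velocity_unique`). -/

namespace HdivFEM

/-! ### Absolutely continuous curves and Carathéodory equations -/

/-- A function whose increments are dominated by those of an absolutely continuous function is
absolutely continuous. -/
theorem absolutelyContinuousOnInterval_of_dist_le {X Y : Type*} [PseudoMetricSpace X]
    [PseudoMetricSpace Y] {f : ℝ → X} {g : ℝ → Y} {a b C : ℝ}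
    (hg : AbsolutelyContinuousOnInterval g a b)
    (h : ∀ s ∈ uIcc a b, ∀ t ∈ uIcc a b, dist (f s) (f t) ≤ C * dist (g s) (g t)) :
    AbsolutelyContinuousOnInterval f a b := by
  rw [absolutelyContinuousOnInterval_iff] at hg ⊢
  intro ε hε
  obtain ⟨δ, hδ, H⟩ := hg (ε / (|C| + 1)) (by positivity)
  refine ⟨δ, hδ, fun E hE hEδ => ?_⟩
  have h1 := H E hE hEδ
  have h2 : ∑ i ∈ Finset.range E.1, dist (f (E.2 i).1) (f (E.2 i).2)
      ≤ (|C| + 1) * ∑ i ∈ Finset.range E.1, dist (g (E.2 i).1) (g (E.2 i).2) := by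
    rw [Finset.mul_sum]
    refine Finset.sum_le_sum fun i hi => ?_
    refine (h _ (hE.1 i hi).1 _ (hE.1 i hi).2).trans ?_
    have := le_abs_self C
    gcongr
    linarith
  calc _ ≤ _ := h2
    _ < (|C| + 1) * (ε / (|C| + 1)) := by gcongr
    _ = ε := by field_simp

section Energy

variable {H : Type*} [NormedAddCommGroup H] [InnerProductSpace ℝ H] [CompleteSpace H]

theorem intervalIntegrable_of_integrableOn_Ioc {E : Type*} [NormedAddCommGroup E] {g : ℝ → E}
    {T s t : ℝ} (hg : IntegrableOn g (Ioc 0 T)) (hs : s ∈ Icc 0 T) (ht : t ∈ Icc 0 T) :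
    IntervalIntegrable g volume s t := by
  rw [intervalIntegrable_iff]
  refine hg.mono_set ?_
  intro r hr
  rcases le_total s t with h | h
  · rw [uIoc_of_le h] at hr
    exact ⟨hs.1.trans_lt hr.1, hr.2.trans ht.2⟩
  · rw [uIoc_of_ge h] at hr
    exact ⟨ht.1.trans_lt hr.1, hr.2.trans hs.2⟩

theorem dist_primitive_le {E : Type*} [NormedAddCommGroup E] [NormedSpace ℝ E] {x g : ℝ → E}
    {T : ℝ} (hg : IntegrableOn g (Ioc 0 T))
    (hx : ∀ t ∈ Icc 0 T, x t = x 0 + ∫ s in (0 : ℝ)..t, g s) {s t : ℝ}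
    (hs : s ∈ Icc 0 T) (ht : t ∈ Icc 0 T) :
    dist (x s) (x t) ≤ dist (∫ r in (0 : ℝ)..s, ‖g r‖) (∫ r in (0 : ℝ)..t, ‖g r‖) := by
  have h0 : (0 : ℝ) ∈ Icc 0 T := ⟨le_rfl, hs.1.trans hs.2⟩
  rw [hx s hs, hx t ht, dist_add_left, dist_eq_norm, dist_eq_norm,
    intervalIntegral.integral_interval_sub_left (intervalIntegrable_of_integrableOn_Ioc hg h0 hs)
      (intervalIntegrable_of_integrableOn_Ioc hg h0 ht),
    intervalIntegral.integral_interval_sub_left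
      (intervalIntegrable_of_integrableOn_Ioc hg.norm h0 hs)
      (intervalIntegrable_of_integrableOn_Ioc hg.norm h0 ht)]
  exact (intervalIntegral.norm_integral_le_abs_integral_norm).trans (by simp)

theorem absolutelyContinuousOnInterval_primitive {E : Type*} [NormedAddCommGroup E]
    [NormedSpace ℝ E] {x g : ℝ → E} {T : ℝ}
    (hg : IntegrableOn g (Ioc 0 T)) (hx : ∀ t ∈ Icc 0 T, x t = x 0 + ∫ s in (0 : ℝ)..t, g s)
    {t : ℝ} (ht : t ∈ Icc 0 T) : AbsolutelyContinuousOnInterval x 0 t := by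
  have h0 : (0 : ℝ) ∈ Icc 0 T := ⟨le_rfl, ht.1.trans ht.2⟩
  have hsub : uIcc 0 t ⊆ Icc 0 T := by
    rw [uIcc_of_le ht.1]; exact Icc_subset_Icc le_rfl ht.2
  refine absolutelyContinuousOnInterval_of_dist_le (C := 1)
    ((intervalIntegrable_of_integrableOn_Ioc hg.norm h0
      ht).absolutelyContinuousOnInterval_intervalIntegral (c := 0) (by simp)) ?_
  intro r hr s hs
  rw [one_mul]
  exact dist_primitive_le hg hx (hsub hr) (hsub hs)

theorem ae_hasDerivAt_primitive {x g : ℝ → H} {T : ℝ} (hT : 0 ≤ T)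
    (hg : IntegrableOn g (Ioc 0 T)) (hx : ∀ t ∈ Icc 0 T, x t = x 0 + ∫ s in (0 : ℝ)..t, g s) :
    ∀ᵐ s, s ∈ Ioo 0 T → HasDerivAt x (g s) s := by
  have h0 : (0 : ℝ) ∈ Icc 0 T := ⟨le_rfl, hT⟩
  have hi := intervalIntegrable_of_integrableOn_Ioc hg h0 ⟨hT, le_rfl⟩
  filter_upwards [hi.ae_hasDerivAt_integral] with s hs hsT
  have h1 := hs (by rw [uIcc_of_le hT]; exact Ioo_subset_Icc_self hsT) 0 (by simp)
  refine (h1.const_add (x 0)).congr_of_eventuallyEq ?_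
  filter_upwards [isOpen_Ioo.mem_nhds hsT] with r hr
  exact hx r (Ioo_subset_Icc_self hr)

theorem absolutelyContinuousOnInterval_norm_sq {E : Type*} [NormedAddCommGroup E] {x : ℝ → E}
    {a b : ℝ}
    (hx : AbsolutelyContinuousOnInterval x a b) :
    AbsolutelyContinuousOnInterval (fun t => ‖x t‖ ^ 2) a b := by
  obtain ⟨R, hR⟩ := hx.exists_bound
  refine absolutelyContinuousOnInterval_of_dist_le (C := 2 * R) hx fun s hs t ht => ?_
  rw [Real.dist_eq, dist_eq_norm]
  have h1 : ‖x s‖ ^ 2 - ‖x t‖ ^ 2 = (‖x s‖ + ‖x t‖) * (‖x s‖ - ‖x t‖) := by ring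
  rw [h1, abs_mul, abs_of_nonneg (by positivity)]
  have h2 := hR s hs
  have h3 := hR t ht
  have h4 := abs_norm_sub_norm_le (x s) (x t)
  have h5 : ‖x s‖ + ‖x t‖ ≤ 2 * R := by linarith
  exact mul_le_mul h5 h4 (abs_nonneg _) (by linarith [norm_nonneg (x s)])

theorem ae_hasDerivAt_norm_sq {x g : ℝ → H} {T : ℝ} (hT : 0 ≤ T)
    (hg : IntegrableOn g (Ioc 0 T)) (hx : ∀ t ∈ Icc 0 T, x t = x 0 + ∫ s in (0 : ℝ)..t, g s) :
    ∀ᵐ s, s ∈ Ioo 0 T → HasDerivAt (fun t => ‖x t‖ ^ 2) (2 * ⟪x s, g s⟫) s := by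
  filter_upwards [ae_hasDerivAt_primitive hT hg hx] with s hs hsT
  exact (hs hsT).norm_sq

/-- The energy identity for an absolutely continuous curve in a Hilbert space. -/
theorem norm_sq_primitive {x g : ℝ → H} {T : ℝ}
    (hg : IntegrableOn g (Ioc 0 T)) (hx : ∀ t ∈ Icc 0 T, x t = x 0 + ∫ s in (0 : ℝ)..t, g s)
    {t : ℝ} (ht : t ∈ Icc 0 T) :
    ‖x t‖ ^ 2 - ‖x 0‖ ^ 2 = ∫ s in (0 : ℝ)..t, 2 * ⟪x s, g s⟫ := by
  rw [← (absolutelyContinuousOnInterval_norm_sq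
    (absolutelyContinuousOnInterval_primitive hg hx ht)).integral_deriv_eq_sub]
  have hne : ∀ᵐ s : ℝ, s ≠ t := by simp [ae_iff, measure_singleton]
  refine intervalIntegral.integral_congr_ae ?_
  filter_upwards [ae_hasDerivAt_norm_sq (ht.1.trans ht.2) hg hx, hne] with s hs hst hsm
  rw [uIoc_of_le ht.1] at hsm
  exact (hs ⟨hsm.1, (lt_of_le_of_ne hsm.2 hst).trans_le ht.2⟩).deriv

/-- A Gronwall inequality with optimal constant: if `‖x‖ (‖x‖)' ≤ φ ‖x‖` then `‖x‖` grows at most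
by the integral of `φ`. -/
theorem norm_primitive_le {x g : ℝ → H} {φ : ℝ → ℝ} {T : ℝ}
    (hg : IntegrableOn g (Ioc 0 T)) (hx : ∀ t ∈ Icc 0 T, x t = x 0 + ∫ s in (0 : ℝ)..t, g s)
    (hφ : IntegrableOn φ (Ioc 0 T)) (hφ0 : ∀ s, 0 ≤ φ s)
    (h : ∀ᵐ s ∂(volume.restrict (Ioc 0 T)), ⟪x s, g s⟫ ≤ φ s * ‖x s‖)
    {t : ℝ} (ht : t ∈ Icc 0 T) :
    ‖x t‖ ≤ ‖x 0‖ + ∫ s in (0 : ℝ)..t, φ s := by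
  have h0 : (0 : ℝ) ∈ Icc 0 T := ⟨le_rfl, ht.1.trans ht.2⟩
  -- The square root is regularised by `ε` to be differentiable along the curve.
  have key : ∀ ε : ℝ, 0 < ε →
      √(‖x t‖ ^ 2 + ε) ≤ √(‖x 0‖ ^ 2 + ε) + ∫ s in (0 : ℝ)..t, φ s := by
    intro ε hε
    have hac : AbsolutelyContinuousOnInterval (fun t => √(‖x t‖ ^ 2 + ε)) 0 t := by
      refine absolutelyContinuousOnInterval_of_dist_le (C := 1 / √ε)
        (absolutelyContinuousOnInterval_norm_sq
          (absolutelyContinuousOnInterval_primitive hg hx ht)) fun r _ s _ => ?_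
      rw [Real.dist_eq, Real.dist_eq]
      set a := ‖x r‖ ^ 2
      set b := ‖x s‖ ^ 2
      have ha : 0 ≤ a := by positivity
      have hb : 0 ≤ b := by positivity
      have hs1 : √ε ≤ √(a + ε) := Real.sqrt_le_sqrt (by linarith)
      have hs2 : 0 < √ε := Real.sqrt_pos.2 hε
      have e1 : a - b = (√(a + ε) - √(b + ε)) * (√(a + ε) + √(b + ε)) := by
        have h1 := Real.mul_self_sqrt (show 0 ≤ a + ε by linarith)
        have h2 := Real.mul_self_sqrt (show 0 ≤ b + ε by linarith)
        linear_combination h2 - h1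
      rw [e1, abs_mul, abs_of_nonneg (a := √(a + ε) + √(b + ε)) (by positivity), div_mul_eq_mul_div,
        one_mul, le_div_iff₀ hs2]
      have := Real.sqrt_nonneg (b + ε)
      gcongr
      linarith
    have h1 := hac.integral_deriv_eq_sub
    have h2 : ∫ s in (0 : ℝ)..t, deriv (fun t => √(‖x t‖ ^ 2 + ε)) s ≤ ∫ s in (0 : ℝ)..t, φ s := by
      refine intervalIntegral.integral_mono_ae_restrict ht.1 hac.intervalIntegrable_deriv
        (intervalIntegrable_of_integrableOn_Ioc hφ h0 ht) ?_
      have hIoc : ∀ᵐ s ∂(volume.restrict (Ioo 0 t)), deriv (fun t => √(‖x t‖ ^ 2 + ε)) s ≤ φ s := by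
        have h' := ae_restrict_of_ae_restrict_of_subset
          (Ioo_subset_Ioc_self.trans (Ioc_subset_Ioc_right ht.2)) h
        filter_upwards [h', ae_restrict_of_ae (ae_hasDerivAt_norm_sq (ht.1.trans ht.2) hg hx),
          self_mem_ae_restrict measurableSet_Ioo] with s hs1 hs2 hs3
        have hp : 0 < ‖x s‖ ^ 2 + ε := by positivity
        have hd := ((hs2 ⟨hs3.1, hs3.2.trans_le ht.2⟩).add_const ε).sqrt hp.ne'
        rw [hd.deriv, mul_div_mul_left _ _ two_ne_zero, div_le_iff₀ (Real.sqrt_pos.2 hp)]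
        refine hs1.trans ?_
        gcongr
        · exact hφ0 s
        · exact Real.le_sqrt_of_sq_le (by linarith)
      rw [← restrict_Ioo_eq_restrict_Icc]
      exact hIoc
    linarith
  have hlim : Filter.Tendsto (fun ε : ℝ => √(‖x 0‖ ^ 2 + ε) + ∫ s in (0 : ℝ)..t, φ s)
      (nhdsWithin 0 (Ioi 0)) (nhds (‖x 0‖ + ∫ s in (0 : ℝ)..t, φ s)) := by
    have hc : Continuous fun ε : ℝ => √(‖x 0‖ ^ 2 + ε) + ∫ s in (0 : ℝ)..t, φ s := by fun_prop
    have := hc.tendsto 0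
    simp only [add_zero, Real.sqrt_sq (norm_nonneg _)] at this
    exact this.mono_left nhdsWithin_le_nhds
  refine ge_of_tendsto hlim ?_
  filter_upwards [self_mem_nhdsWithin] with ε hε
  refine le_trans ?_ (key ε hε)
  exact Real.le_sqrt_of_sq_le (by linarith [show (0 : ℝ) < ε from hε])

end Energy

section ODE

variable {E : Type*} [NormedAddCommGroup E] [NormedSpace ℝ E] [CompleteSpace E]

/-- Existence for an ordinary differential equation whose right-hand side is Lipschitz in the state
and merely integrable in time (Carathéodory). -/
theorem exists_caratheodory_solution {T L : ℝ} (hT : 0 ≤ T) (hL : 0 ≤ L) (Φ : ℝ → E → E) (u₀ : E)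
    (hmeas : ∀ u : ℝ → E, Continuous u →
      AEStronglyMeasurable (fun s => Φ s (u s)) (volume.restrict (Ioc 0 T)))
    (hlip : ∀ᵐ s ∂(volume.restrict (Ioc 0 T)), ∀ x y, ‖Φ s x - Φ s y‖ ≤ L * ‖x - y‖)
    (hint : IntegrableOn (fun s => Φ s 0) (Ioc 0 T)) :
    ∃ u : ℝ → E, Continuous u ∧ IntegrableOn (fun s => Φ s (u s)) (Ioc 0 T) ∧
      ∀ t ∈ Icc 0 T, u t = u₀ + ∫ s in (0 : ℝ)..t, Φ s (u s) := by
  have hInt : ∀ u : ℝ → E, Continuous u → IntegrableOn (fun s => Φ s (u s)) (Ioc 0 T) := by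
    intro u hu
    have hb : IntegrableOn (fun s => L * ‖u s‖ + ‖Φ s 0‖) (Ioc 0 T) := by
      refine Integrable.add ?_ hint.norm
      exact ((continuous_const.mul hu.norm).continuousOn.integrableOn_Icc).mono_set
        Ioc_subset_Icc_self
    refine Integrable.mono' hb (hmeas u hu) ?_
    filter_upwards [hlip] with s hs
    have := hs (u s) 0
    rw [sub_zero] at this
    calc ‖Φ s (u s)‖ = ‖(Φ s (u s) - Φ s 0) + Φ s 0‖ := by simp
      _ ≤ _ := (norm_add_le _ _).trans (by gcongr)
  set I := Icc (0 : ℝ) T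
  -- In the weighted norm `sup_t e^{-lam t} ‖u t‖` the Picard map is a contraction.
  set lam : ℝ := 2 * L + 1
  have hlam : 0 < lam := by positivity
  let ext : C(I, E) → ℝ → E := fun v s => Real.exp (lam * s) • v (projIcc 0 T hT s)
  have hext : ∀ v, Continuous (ext v) := fun v => by
    have : Continuous fun s => v (projIcc 0 T hT s) := v.continuous.comp continuous_projIcc
    fun_prop
  have hprim : ∀ v : C(I, E), ContinuousOn (fun t => ∫ s in (0 : ℝ)..t, Φ s (ext v s)) I := by
    intro v
    have := intervalIntegral.continuousOn_primitive_interval (μ := volume) (a := 0) (b := T)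
      (f := fun s => Φ s (ext v s))
      (by rw [uIcc_of_le hT, integrableOn_Icc_iff_integrableOn_Ioc]; exact hInt _ (hext v))
    rwa [uIcc_of_le hT] at this
  let P : C(I, E) → C(I, E) := fun v =>
    ⟨fun t => Real.exp (-(lam * t)) • (u₀ + ∫ s in (0 : ℝ)..t, Φ s (ext v s)), by
      have h1 := continuousOn_iff_continuous_domRestrict.1 (hprim v)
      have h2 : Continuous fun t : I => ∫ s in (0 : ℝ)..t, Φ s (ext v s) := h1
      have h3 : Continuous fun t : I => Real.exp (-(lam * (t : ℝ))) := by fun_prop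
      exact h3.smul (continuous_const.add h2)⟩
  have hP : ContractingWith (1 / 2) P := by
    refine ⟨by norm_num, LipschitzWith.of_dist_le_mul fun v w => ?_⟩
    rw [ContinuousMap.dist_le (by positivity)]
    intro t
    have h0 : (0 : ℝ) ∈ Icc 0 T := ⟨le_rfl, hT⟩
    have hiv := intervalIntegrable_of_integrableOn_Ioc (hInt _ (hext v)) h0 t.2
    have hiw := intervalIntegrable_of_integrableOn_Ioc (hInt _ (hext w)) h0 t.2
    have e1 : (P v) t - (P w) t = Real.exp (-(lam * t)) •
        ∫ s in (0 : ℝ)..t, (Φ s (ext v s) - Φ s (ext w s)) := by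
      rw [intervalIntegral.integral_sub hiv hiw]
      simp only [P, ContinuousMap.coe_mk]
      rw [← smul_sub, add_sub_add_left_eq_sub]
    rw [dist_eq_norm, e1, norm_smul, Real.norm_eq_abs, Real.abs_exp]
    have hb : ‖∫ s in (0 : ℝ)..t, (Φ s (ext v s) - Φ s (ext w s))‖
        ≤ ∫ s in (0 : ℝ)..t, L * dist v w * Real.exp (lam * s) := by
      refine intervalIntegral.norm_integral_le_of_norm_le t.2.1 ?_ ?_
      · have := (ae_restrict_iff' measurableSet_Ioc).1 hlip
        filter_upwards [this] with s hs hst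
        refine (hs ⟨hst.1, hst.2.trans t.2.2⟩ _ _).trans ?_
        rw [← smul_sub, norm_smul, Real.norm_eq_abs, Real.abs_exp, ← dist_eq_norm]
        have := ContinuousMap.dist_apply_le_dist (f := v) (g := w) (projIcc 0 T hT s)
        calc L * (Real.exp (lam * s) * dist (v (projIcc 0 T hT s)) (w (projIcc 0 T hT s)))
            ≤ L * (Real.exp (lam * s) * dist v w) := by gcongr
          _ = _ := by ring
      · exact Continuous.intervalIntegrable (by fun_prop) _ _
    have he : ∫ s in (0 : ℝ)..t, L * dist v w * Real.exp (lam * s)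
        = L * dist v w * ((Real.exp (lam * t) - 1) / lam) := by
      rw [intervalIntegral.integral_const_mul,
        intervalIntegral.integral_comp_mul_left (fun s => Real.exp s) hlam.ne', integral_exp]
      simp [div_eq_inv_mul]
    have hd : 0 ≤ dist v w := dist_nonneg
    calc Real.exp (-(lam * t)) * ‖∫ s in (0 : ℝ)..t, (Φ s (ext v s) - Φ s (ext w s))‖
        ≤ Real.exp (-(lam * t)) * (L * dist v w * ((Real.exp (lam * t) - 1) / lam)) := by
          rw [← he]; gcongr
      _ = L / lam * dist v w * (1 - Real.exp (-(lam * t))) := by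
          rw [Real.exp_neg]
          field_simp [(Real.exp_pos (lam * t)).ne']
      _ ≤ L / lam * dist v w * 1 := by
          gcongr
          linarith [Real.exp_pos (-(lam * t))]
      _ ≤ 1 / 2 * dist v w := by
          have hq : L / lam ≤ 1 / 2 := by
            rw [div_le_iff₀ hlam]
            simp only [lam]; linarith
          rw [mul_one]
          gcongr
      _ = _ := by simp
  have : Nonempty C(I, E) := ⟨0⟩
  set v := ContractingWith.fixedPoint P hP
  have hv : P v = v := hP.fixedPoint_isFixedPt
  refine ⟨ext v, hext v, hInt _ (hext v), fun t ht => ?_⟩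
  have h1 : (P v) ⟨t, ht⟩ = v ⟨t, ht⟩ := by rw [hv]
  have h2 : ext v t = Real.exp (lam * t) • v ⟨t, ht⟩ := by
    simp only [ext, projIcc_of_mem hT ht]
  rw [h2, ← h1]
  simp only [P, ContinuousMap.coe_mk]
  rw [smul_smul, ← Real.exp_add]
  simp

end ODE

/-! ### Semi-discrete saddle point problems -/

/-- A functional vanishing on the kernel of a bilinear form is represented by a multiplier that
depends linearly on the functional. -/
theorem exists_linear_multiplier {V Q : Type*} [AddCommGroup V] [Module ℝ V] [AddCommGroup Q]
    [Module ℝ Q] [FiniteDimensional ℝ Q] (b : V →ₗ[ℝ] Q →ₗ[ℝ] ℝ) :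
    ∃ L : Module.Dual ℝ V →ₗ[ℝ] Q,
      ∀ φ : Module.Dual ℝ V, (∀ v, b v = 0 → φ v = 0) → ∀ v, b v (L φ) = φ v := by
  let B : Q →ₗ[ℝ] Module.Dual ℝ V := b.flip
  have : Module.Free ℝ (LinearMap.range B) :=
    Module.Free.of_divisionRing ℝ (LinearMap.range B)
  obtain ⟨G, hG⟩ := B.rangeRestrict.exists_rightInverse_of_surjective
    (LinearMap.range_rangeRestrict _)
  obtain ⟨L, hL⟩ := LinearMap.exists_extend G
  refine ⟨L, fun φ hφ v => ?_⟩
  have hmem : φ ∈ LinearMap.range B := by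
    rw [show B = b.flip from rfl, ← LinearMap.dualAnnihilator_ker_eq_range_flip,
      Submodule.mem_dualAnnihilator]
    exact fun w hw => hφ w hw
  have h1 : L φ = G ⟨φ, hmem⟩ := by rw [← hL]; rfl
  have h2 := LinearMap.congr_fun hG ⟨φ, hmem⟩
  have h3 : b.flip (G ⟨φ, hmem⟩) = φ := congrArg Subtype.val h2
  rw [h1]
  exact LinearMap.congr_fun h3 v

/-- Existence for a semi-discrete saddle point problem with coefficients that are bounded and
measurable in time: the velocity solves an ordinary differential equation on the kernel of the
constraint, and the multiplier recovers the part of the residual that the kernel does not see. -/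
theorem exists_galerkin_solution {V Q H G : Type*} [AddCommGroup V] [Module ℝ V]
    [FiniteDimensional ℝ V] [AddCommGroup Q] [Module ℝ Q] [FiniteDimensional ℝ Q]
    [NormedAddCommGroup H] [InnerProductSpace ℝ H] [CompleteSpace H] [NormedAddCommGroup G]
    [NormedSpace ℝ G] (J : V →ₗ[ℝ] H) (hJ : Function.Injective J) (JQ : Q →ₗ[ℝ] G)
    (b : V →ₗ[ℝ] Q →ₗ[ℝ] ℝ) {T : ℝ} (hT : 0 ≤ T) (A : ℝ → V →ₗ[ℝ] V →ₗ[ℝ] ℝ)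
    (hAm : ∀ w v, AEStronglyMeasurable (fun t => A t w v) (volume.restrict (Ioc 0 T)))
    (hAb : ∀ w v, ∃ C, ∀ᵐ t ∂(volume.restrict (Ioc 0 T)), |A t w v| ≤ C)
    (f : ℝ → H) (hf : MemLp f 1 (volume.restrict (Ioc 0 T))) (u₀ : V) (hu₀ : b u₀ = 0) :
    ∃ (n : ℕ) (e : Fin n → V) (ξ : ℝ → Fin n → ℝ) (u u' : ℝ → V) (p : ℝ → Q),
      Continuous ξ ∧ (∀ t, u t = ∑ i, ξ t i • e i) ∧ u 0 = u₀ ∧ (∀ t, b (u t) = 0) ∧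
      (∀ t ∈ Icc 0 T, J (u t) = J (u 0) + ∫ s in (0 : ℝ)..t, J (u' s)) ∧
      (∀ t v q, ⟪J (u' t), J v⟫ + A t (u t) v + b v (p t) - b (u t) q = ⟪f t, J v⟫) ∧
      ∀ r : ℝ≥0∞, MemLp f r (volume.restrict (Ioc 0 T)) →
        MemLp (fun t => J (u t)) r (volume.restrict (Ioc 0 T)) ∧
        MemLp (fun t => J (u' t)) r (volume.restrict (Ioc 0 T)) ∧
        MemLp (fun t => JQ (p t)) r (volume.restrict (Ioc 0 T)) := by
  classical
  set μ := volume.restrict (Ioc 0 T)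
  have hTmem : (0 : ℝ) ∈ Icc 0 T := ⟨le_rfl, hT⟩
  -- An `H`-orthonormal basis of the kernel turns the projected equation into an explicit one.
  let S : Submodule ℝ H := (LinearMap.ker b).map J
  have : FiniteDimensional ℝ S := inferInstance
  let o := stdOrthonormalBasis ℝ S
  set n := Module.finrank ℝ S
  have hex : ∀ i : Fin n, ∃ v : V, b v = 0 ∧ J v = o i := fun i => by
    obtain ⟨v, hv, hv'⟩ := (o i).2
    exact ⟨v, hv, hv'⟩
  choose e he0 heJ using hex
  have hdec : ∀ v : V, b v = 0 → v = ∑ i, ⟪J (e i), J v⟫ • e i := by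
    intro v hv
    apply hJ
    have hvS : J v ∈ S := ⟨v, hv, rfl⟩
    have h1 := congrArg Subtype.val (o.sum_repr' ⟨J v, hvS⟩)
    rw [map_sum]
    simp only [map_smul, heJ]
    rw [Submodule.coe_sum] at h1
    simpa using h1.symm
  have hort : ∀ i j, ⟪J (e i), J (e j)⟫ = if i = j then (1 : ℝ) else 0 := by
    intro i j
    rw [heJ, heJ, ← Submodule.coe_inner]
    exact (orthonormal_iff_ite.1 o.orthonormal) i j
  let Φ : ℝ → (Fin n → ℝ) → Fin n → ℝ := fun s x i =>
    ⟪f s, J (e i)⟫ - ∑ j, x j * A s (e j) (e i)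
  choose C hC using fun j i => hAb (e j) (e i)
  have hall : ∀ᵐ t ∂μ, ∀ j i, |A t (e j) (e i)| ≤ C j i :=
    ae_all_iff.2 fun j => ae_all_iff.2 fun i => hC j i
  have hmeas : ∀ u : ℝ → Fin n → ℝ, Continuous u → ∀ i,
      AEStronglyMeasurable (fun s => Φ s (u s) i) μ := by
    intro u hu i
    refine (hf.inner_const (J (e i))).aestronglyMeasurable.sub ?_
    refine Finset.aestronglyMeasurable_fun_sum _ fun j _ => ?_
    exact ((continuous_apply j).comp hu).aestronglyMeasurable.mul (hAm _ _)
  obtain ⟨ξ, hξc, hξi, hξ⟩ := exists_caratheodory_solution (E := Fin n → ℝ) (T := T)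
    (L := ∑ i, ∑ j, |C j i|) hT (by positivity) Φ (fun i => ⟪J (e i), J u₀⟫)
    (fun u hu => (aemeasurable_pi_iff.2 fun i => (hmeas u hu i).aemeasurable).aestronglyMeasurable)
    (by
      filter_upwards [hall] with s hs x y
      rw [pi_norm_le_iff_of_nonneg (by positivity)]
      intro i
      have h1 : (Φ s x - Φ s y) i = ∑ j, (y j - x j) * A s (e j) (e i) := by
        simp only [Φ, Pi.sub_apply, sub_mul, Finset.sum_sub_distrib]
        ring
      rw [h1]
      calc ‖∑ j, (y j - x j) * A s (e j) (e i)‖ ≤ ∑ j, ‖x - y‖ * |C j i| := by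
            refine norm_sum_le_of_le _ fun j _ => ?_
            rw [norm_mul, norm_sub_rev]
            have h2 : ‖x j - y j‖ ≤ ‖x - y‖ := norm_le_pi_norm (x - y) j
            have h3 : ‖A s (e j) (e i)‖ ≤ |C j i| := (hs j i).trans (le_abs_self _)
            gcongr
        _ = (∑ j, |C j i|) * ‖x - y‖ := by rw [Finset.sum_mul]; simp_rw [mul_comm]
        _ ≤ _ := mul_le_mul_of_nonneg_right
            (Finset.single_le_sum (f := fun i => ∑ j, |C j i|) (fun i _ => by positivity)
              (Finset.mem_univ i)) (norm_nonneg _))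
    (by
      refine Integrable.of_eval fun i => ?_
      simp only [Φ, Pi.zero_apply, zero_mul, Finset.sum_const_zero, sub_zero]
      exact memLp_one_iff_integrable.1 (hf.inner_const (J (e i))))
  obtain ⟨L, hL⟩ := exists_linear_multiplier b
  let lc : (Fin n → ℝ) →ₗ[ℝ] V := Fintype.linearCombination ℝ e
  have hlc : ∀ x, lc x = ∑ i, x i • e i := fun x => Fintype.linearCombination_apply ℝ e x
  let JL : (Fin n → ℝ) →L[ℝ] H := LinearMap.toContinuousLinearMap (J.comp lc)
  let u : ℝ → V := fun t => lc (ξ t)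
  let u' : ℝ → V := fun t => lc (Φ t (ξ t))
  have hlc0 : ∀ x, b (lc x) = 0 := fun x => by
    rw [hlc, map_sum]
    exact Finset.sum_eq_zero fun i _ => by rw [map_smul, he0, smul_zero]
  let R : ℝ → Module.Dual ℝ V := fun t =>
    (innerₗ H (f t - J (u' t))).comp J - A t (u t)
  have hRv : ∀ t v, R t v = ⟪f t, J v⟫ - ⟪J (u' t), J v⟫ - A t (u t) v := fun t v => by
    simp [R]
  have hRe : ∀ t i, R t (e i) = 0 := by
    intro t i
    have h1 : ⟪J (u' t), J (e i)⟫ = Φ t (ξ t) i := by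
      simp only [u', hlc, map_sum, map_smul, sum_inner, real_inner_smul_left, hort]
      simp
    have h2 : A t (u t) (e i) = ∑ j, ξ t j * A t (e j) (e i) := by
      simp only [u, hlc, map_sum, map_smul, LinearMap.sum_apply, LinearMap.smul_apply, smul_eq_mul]
    rw [hRv, h1, h2]
    simp only [Φ]
    ring
  have hRD : ∀ t v, b v = 0 → R t v = 0 := by
    intro t v hv
    rw [hdec v hv, map_sum]
    exact Finset.sum_eq_zero fun i _ => by rw [map_smul, hRe, smul_zero]
  have hu0 : u 0 = u₀ := by
    have h1 := hξ 0 hTmem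
    simp only [intervalIntegral.integral_same, add_zero] at h1
    simp only [u, h1, hlc]
    exact (hdec u₀ hu₀).symm
  refine ⟨n, e, ξ, u, u', fun t => L (R t), hξc, fun t => hlc _, hu0, fun t => hlc0 _, ?_, ?_, ?_⟩
  · intro t ht
    have h1 : JL (ξ t) = JL (ξ 0) + JL (∫ s in (0 : ℝ)..t, Φ s (ξ s)) := by
      rw [hξ t ht, hξ 0 hTmem]
      simp only [intervalIntegral.integral_same, add_zero, map_add]
    rw [← ContinuousLinearMap.intervalIntegral_comp_comm _
      (intervalIntegrable_of_integrableOn_Ioc hξi hTmem ht)] at h1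
    exact h1
  · intro t v q
    rw [hlc0, hL (R t) (hRD t), hRv]
    simp
  · intro r hr
    obtain ⟨B, hB⟩ := (isCompact_Icc (a := (0 : ℝ)) (b := T)).exists_bound_of_continuousOn
      hξc.continuousOn
    have hBae : ∀ᵐ t ∂μ, ‖ξ t‖ ≤ B := by
      filter_upwards [self_mem_ae_restrict measurableSet_Ioc] with t ht
      exact hB t (Ioc_subset_Icc_self ht)
    have hξr : MemLp ξ r μ := MemLp.of_bound hξc.aestronglyMeasurable B hBae
    have hAr : ∀ v, MemLp (fun t => A t (u t) v) r μ := by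
      intro v
      have h1 : (fun t => A t (u t) v) = fun t => ∑ j, ξ t j * A t (e j) v := by
        funext t
        simp only [u, hlc, map_sum, map_smul, LinearMap.sum_apply, LinearMap.smul_apply,
          smul_eq_mul]
      rw [h1]
      refine memLp_finsetSum _ fun j _ => ?_
      obtain ⟨c, hc⟩ := hAb (e j) v
      refine MemLp.of_bound (((continuous_apply j).comp hξc).aestronglyMeasurable.mul (hAm _ _))
        (B * c) ?_
      filter_upwards [hc, hBae] with t h2 h3
      rw [norm_mul]
      exact mul_le_mul ((norm_le_pi_norm _ j).trans h3) h2 (norm_nonneg _)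
        ((norm_nonneg _).trans h3)
    have hΦr : MemLp (fun t => Φ t (ξ t)) r μ := by
      refine MemLp.of_eval fun i => ?_
      have h1 : (fun t => Φ t (ξ t) i) = fun t => ⟪f t, J (e i)⟫ - A t (u t) (e i) := by
        funext t
        simp only [Φ, u, hlc, map_sum, map_smul, LinearMap.sum_apply, LinearMap.smul_apply,
          smul_eq_mul]
      rw [h1]
      exact (hr.inner_const _).sub (hAr _)
    have hu'r : MemLp (fun t => J (u' t)) r μ := JL.comp_memLp' hΦr
    refine ⟨JL.comp_memLp' hξr, hu'r, ?_⟩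
    let β := Module.finBasis ℝ V
    have h1 : (fun t => JQ (L (R t))) = fun t => ∑ k, R t (β k) • JQ (L (β.coord k)) := by
      funext t
      conv_lhs => rw [← β.sum_dual_apply_smul_coord (R t)]
      simp only [map_sum, map_smul]
    rw [h1]
    refine memLp_finsetSum _ fun k _ => ?_
    have h2 : MemLp (fun t => R t (β k)) r μ := by
      have h3 : (fun t => R t (β k))
          = fun t => ⟪f t, J (β k)⟫ - ⟪J (u' t), J (β k)⟫ - A t (u t) (β k) := by
        funext t; exact hRv t _
      rw [h3]
      exact ((hr.inner_const _).sub (hu'r.inner_const _)).sub (hAr _)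
    exact (ContinuousLinearMap.toSpanSingleton ℝ (JQ (L (β.coord k)))).comp_memLp' h2

/-! ### Integration over cones and one-dimensional polynomials -/

section Hyperplane

variable {V : Type*} [NormedAddCommGroup V] [InnerProductSpace ℝ V]

theorem finrank_orthogonal_singleton {n : V} (hn : ‖n‖ = 1) {k : ℕ}
    (hk : Module.finrank ℝ V = k + 1) : Module.finrank ℝ (ℝ ∙ n)ᗮ = k := by
  have : Fact (Module.finrank ℝ V = k + 1) := ⟨hk⟩
  exact Submodule.finrank_orthogonal_span_singleton (by rintro rfl; simp at hn)

theorem isometry_hyperplane (n : V) (c : ℝ) :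
    Isometry (fun z : (ℝ ∙ n)ᗮ => c • n + (z : V)) :=
  Isometry.of_dist_eq fun x y => by rw [dist_add_left]; rfl

theorem mem_range_hyperplane {n : V} (hn : ‖n‖ = 1) {c : ℝ} {y : V} (hy : ⟪n, y⟫ = c) :
    ∃ z : (ℝ ∙ n)ᗮ, c • n + (z : V) = y := by
  refine ⟨⟨y - c • n, ?_⟩, by simp⟩
  rw [Submodule.mem_orthogonal_singleton_iff_inner_right, inner_sub_right, hy,
    real_inner_smul_right, real_inner_self_eq_norm_sq, hn]
  ring

variable [FiniteDimensional ℝ V] [MeasurableSpace V] [BorelSpace V]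

/-- Orthogonal coordinates along a unit vector and in its orthogonal complement preserve volume. -/
theorem measurePreserving_smul_add_orthogonal {n : V} (hn : ‖n‖ = 1) :
    MeasurePreserving (fun q : ℝ × (ℝ ∙ n)ᗮ => q.1 • n + (q.2 : V)) volume volume := by
  have h1 := ((ℝ ∙ n).measurePreserving_measurableEquivProd (0 : V)).symm
  rw [InnerProductSpace.euclideanHausdorffMeasure_eq_volume] at h1
  have h2 := (LinearIsometryEquiv.toSpanUnitSingleton (𝕜 := ℝ) n hn).measurePreserving
  have h3 := h2.prod (MeasurePreserving.id (volume : Measure (ℝ ∙ n)ᗮ))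
  convert! h1.comp h3 using 1
  funext q
  simp [Prod.map]

/-- On a hyperplane the Euclidean Hausdorff measure is the Lebesgue measure of the direction. -/
theorem euclideanHausdorffMeasure_restrict_hyperplane {n : V} (hn : ‖n‖ = 1) {k : ℕ}
    (hk : Module.finrank ℝ V = k + 1) {c : ℝ} {F : Set V} (hF : ∀ y ∈ F, ⟪n, y⟫ = c)
    (hFm : MeasurableSet F) :
    (Measure.euclideanHausdorffMeasure k : Measure V).restrict F =
      ((volume : Measure (ℝ ∙ n)ᗮ).restrict ((fun z : (ℝ ∙ n)ᗮ => c • n + (z : V)) ⁻¹' F)).map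
        (fun z : (ℝ ∙ n)ᗮ => c • n + (z : V)) := by
  have h1 := (isometry_hyperplane n c).map_euclideanHausdorffMeasure (d := k)
  have h2 : (Measure.euclideanHausdorffMeasure k : Measure (ℝ ∙ n)ᗮ) = volume := by
    rw [← finrank_orthogonal_singleton hn hk]
    exact InnerProductSpace.euclideanHausdorffMeasure_eq_volume
  rw [h2] at h1
  rw [← Measure.restrict_map (isometry_hyperplane n c).continuous.measurable hFm, h1,
    Measure.restrict_restrict_of_subset]
  intro y hy
  exact mem_range_hyperplane hn (hF y hy)

theorem isFiniteMeasure_restrict_hyperplane {n : V} (hn : ‖n‖ = 1) {k : ℕ}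
    (hk : Module.finrank ℝ V = k + 1) {c : ℝ} {F : Set V} (hF : ∀ y ∈ F, ⟪n, y⟫ = c)
    (hFc : IsCompact F) :
    IsFiniteMeasure ((Measure.euclideanHausdorffMeasure k : Measure V).restrict F) := by
  rw [euclideanHausdorffMeasure_restrict_hyperplane hn hk hF hFc.measurableSet]
  have hc : IsCompact ((fun z : (ℝ ∙ n)ᗮ => c • n + (z : V)) ⁻¹' F) :=
    (isometry_hyperplane n c).isClosedEmbedding.isCompact_preimage hFc
  have : IsFiniteMeasure ((volume : Measure (ℝ ∙ n)ᗮ).restrict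
      ((fun z : (ℝ ∙ n)ᗮ => c • n + (z : V)) ⁻¹' F)) := ⟨by simpa using hc.measure_lt_top⟩
  infer_instance

/-- Integration over the cone with base `F` and apex `x₀`, bounded by the integral over a convex set
containing the cone. -/
theorem integral_cone_le {n : V} (hn : ‖n‖ = 1) {k : ℕ}
    (hk : Module.finrank ℝ V = k + 1) {c : ℝ} {K F : Set V} (hK : Convex ℝ K) (hKc : IsCompact K)
    (hFK : F ⊆ K) (hFc : IsCompact F) (hF : ∀ y ∈ F, ⟪n, y⟫ = c) {x₀ : V} (hx₀ : x₀ ∈ K)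
    {h : ℝ} (hh : 0 < h) (hhc : ⟪n, x₀⟫ + h = c) {g : V → ℝ} (hg : Continuous g)
    (hg0 : ∀ x, 0 ≤ g x) :
    h * ∫ s in (0 : ℝ)..1, s ^ k * ∫ y in F, g (x₀ + s • (y - x₀))
      ∂(Measure.euclideanHausdorffMeasure k) ≤ ∫ x in K, g x := by
  set W := (ℝ ∙ n)ᗮ
  set F' : Set W := (fun z : W => c • n + (z : V)) ⁻¹' F
  have hF'm : MeasurableSet F' := (isometry_hyperplane n c).continuous.measurable hFc.measurableSet
  have hF'c : IsCompact F' := (isometry_hyperplane n c).isClosedEmbedding.isCompact_preimage hFc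
  set a : ℝ := ⟪n, x₀⟫
  obtain ⟨z₀, hz₀⟩ := mem_range_hyperplane hn (show ⟪n, x₀⟫ = a from rfl)
  let Ψ : ℝ × W → V := fun q => q.1 • n + (q.2 : V)
  have hΨ : MeasurePreserving Ψ volume volume := measurePreserving_smul_add_orthogonal hn
  have hgK : Integrable (K.indicator g) :=
    (integrable_indicator_iff hKc.measurableSet).2 (hg.continuousOn.integrableOn_compact hKc)
  have hgK0 : ∀ x, 0 ≤ K.indicator g x := fun x => indicator_nonneg (fun x _ => hg0 x) x
  have hcomp : Integrable (fun q => K.indicator g (Ψ q)) (volume : Measure (ℝ × W)) :=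
    hΨ.integrable_comp_of_integrable hgK
  let I : ℝ → ℝ := fun τ => ∫ z : W, K.indicator g (τ • n + (z : V))
  have hI : Integrable I := hcomp.integral_prod_left
  have hI0 : ∀ τ, 0 ≤ I τ := fun τ => integral_nonneg fun z => hgK0 _
  have e1 : ∫ x in K, g x = ∫ τ, I τ := by
    rw [← integral_indicator hKc.measurableSet, ← hΨ.map_eq,
      integral_map hΨ.measurable.aemeasurable (by rw [hΨ.map_eq]; exact hgK.aestronglyMeasurable)]
    exact integral_prod _ hcomp
  have e2 : h * ∫ s in (0 : ℝ)..1, I (h * s + a) = ∫ τ in a..c, I τ := by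
    have := intervalIntegral.smul_integral_comp_mul_add (a := 0) (b := 1) I h a
    rw [smul_eq_mul] at this
    rw [this]
    congr 1
    · ring
    · linarith
  have e3 : ∫ τ in a..c, I τ ≤ ∫ τ, I τ := by
    rw [intervalIntegral.integral_of_le (by linarith)]
    exact setIntegral_le_integral hI (Filter.Eventually.of_forall hI0)
  have hFint : ∀ s : ℝ, ∫ y in F, g (x₀ + s • (y - x₀)) ∂(Measure.euclideanHausdorffMeasure k)
      = ∫ z in F', g (x₀ + s • (c • n + (z : V) - x₀)) := by
    intro s
    have hgs : Continuous fun y => g (x₀ + s • (y - x₀)) := hg.comp (by fun_prop)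
    rw [euclideanHausdorffMeasure_restrict_hyperplane hn hk hF hFc.measurableSet,
      integral_map (isometry_hyperplane n c).continuous.measurable.aemeasurable
        hgs.aestronglyMeasurable]
  simp only [hFint]
  -- The slice of the cone at relative height `s` is a copy of `F` scaled by `s`.
  have key : ∀ s ∈ Ioc (0 : ℝ) 1, s ^ k * ∫ z in F', g (x₀ + s • (c • n + (z : V) - x₀))
      ≤ I (h * s + a) := by
    intro s hs
    set τ := h * s + a
    have hslice : Integrable (fun z : W => K.indicator g (τ • n + (z : V))) := by
      have hc : IsCompact ((fun z : W => τ • n + (z : V)) ⁻¹' K) :=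
        (isometry_hyperplane n τ).isClosedEmbedding.isCompact_preimage hKc
      have : (fun z : W => K.indicator g (τ • n + (z : V)))
          = ((fun z : W => τ • n + (z : V)) ⁻¹' K).indicator
            (fun z : W => g (τ • n + (z : V))) := by
        funext z; rfl
      rw [this, integrable_indicator_iff hc.measurableSet]
      exact (hg.comp (by fun_prop)).continuousOn.integrableOn_compact hc
    have hshift : Integrable (fun z : W => K.indicator g (τ • n + ((z₀ + s • (z - z₀) : W) : V))) :=
      (((hslice.comp_add_left z₀).comp_smul hs.1.ne').comp_sub_right z₀)
    have e4 : I τ = s ^ k * ∫ z : W, K.indicator g (τ • n + ((z₀ + s • (z - z₀) : W) : V)) := by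
      rw [integral_sub_right_eq_self
        (fun z : W => K.indicator g (τ • n + ((z₀ + s • z : W) : V))) z₀,
        Measure.integral_comp_smul_of_nonneg volume
          (fun z : W => K.indicator g (τ • n + ((z₀ + z : W) : V))) s (hR := hs.1.le),
        integral_add_left_eq_self (fun z : W => K.indicator g (τ • n + ((z : W) : V))) z₀,
        finrank_orthogonal_singleton hn hk, smul_eq_mul, ← mul_assoc,
        mul_inv_cancel₀ (pow_ne_zero _ hs.1.ne'), one_mul]
    rw [e4]
    refine mul_le_mul_of_nonneg_left ?_ (pow_nonneg hs.1.le _)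
    refine le_trans (le_of_eq ?_) (setIntegral_le_integral (s := F')
      hshift (Filter.Eventually.of_forall fun z => hgK0 _))
    refine setIntegral_congr_fun hF'm fun z hz => ?_
    have hpt : x₀ + s • (c • n + (z : V) - x₀) = τ • n + ((z₀ + s • (z - z₀) : W) : V) := by
      rw [← hz₀, ← hhc]
      simp only [τ, Submodule.coe_add, Submodule.coe_smul, Submodule.coe_sub]
      module
    have hmem : x₀ + s • (c • n + (z : V) - x₀) ∈ K :=
      hK.add_smul_sub_mem hx₀ (hFK hz) ⟨hs.1.le, hs.2⟩
    rw [← hpt, indicator_of_mem hmem]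
  have hIs : IntervalIntegrable (fun s => I (h * s + a)) volume 0 1 :=
    ((hI.comp_add_right a).comp_mul_left' hh.ne').intervalIntegrable
  have hcont : Continuous fun s : ℝ => s ^ k * ∫ z in F', g (x₀ + s • (c • n + (z : V) - x₀)) := by
    refine (continuous_pow k).mul ?_
    exact continuous_parametric_integral_of_continuous (by fun_prop) hF'c
  calc _ ≤ h * ∫ s in (0 : ℝ)..1, I (h * s + a) := by
        refine mul_le_mul_of_nonneg_left ?_ hh.le
        exact intervalIntegral.integral_mono_on_of_le_Ioo zero_le_one
          (hcont.intervalIntegrable _ _) hIs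
          fun s hs => key s (Ioo_subset_Ioc_self hs)
    _ ≤ _ := by rw [e2, e1]; exact e3

end Hyperplane

section Polynomial

/-- On polynomials of bounded degree the value at `1` is controlled by a weighted `L²` norm, since
all norms on a finite-dimensional space are equivalent. -/
theorem exists_eval_one_sq_le (m k : ℕ) : ∃ C : ℝ, 0 < C ∧ ∀ q : Polynomial ℝ, q.natDegree ≤ m →
    q.eval 1 ^ 2 ≤ C * ∫ s in (0 : ℝ)..1, s ^ k * q.eval s ^ 2 := by
  -- Polynomials are represented by their coefficients; `φ` is a positive definite quadratic form,
  -- bounded below on the unit sphere by compactness.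
  let ev : (Fin (m + 1) → ℝ) → ℝ → ℝ := fun c s => ∑ i, c i * s ^ (i : ℕ)
  let φ : (Fin (m + 1) → ℝ) → ℝ := fun c => ∫ s in (0 : ℝ)..1, s ^ k * ev c s ^ 2
  have hφc : Continuous φ :=
    intervalIntegral.continuous_parametric_intervalIntegral_of_continuous'
      (by simp only [ev]; fun_prop) 0 1
  have hφpos : ∀ c, c ≠ 0 → 0 < φ c := by
    intro c hc
    let P : Polynomial ℝ := ∑ i : Fin (m + 1), Polynomial.C (c i) * Polynomial.X ^ (i : ℕ)
    have hPe : ∀ s, P.eval s = ev c s := fun s => by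
      simp [P, ev, Polynomial.eval_finsetSum]
    have hP : P ≠ 0 := by
      intro h0
      apply hc
      funext i
      have h1 : P.coeff i = c i := by
        simp only [P, Polynomial.finsetSum_coeff, Polynomial.coeff_C_mul, Polynomial.coeff_X_pow]
        simp [Fin.ext_iff.symm]
      rw [← h1, h0]; simp
    obtain ⟨s, hs, hsr⟩ : ∃ s ∈ Ioo (0 : ℝ) 1, P.eval s ≠ 0 := by
      by_contra! hcon
      exact hP (Polynomial.eq_zero_of_infinite_isRoot P
        ((Ioo_infinite (zero_lt_one' ℝ)).mono fun s hs => hcon s hs))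
    refine intervalIntegral.integral_pos zero_lt_one (by simp only [ev]; fun_prop)
      (fun r hr => mul_nonneg (pow_nonneg hr.1.le _) (sq_nonneg _)) ⟨s, Ioo_subset_Icc_self hs, ?_⟩
    rw [hPe] at hsr
    have := hs.1
    positivity
  have hne : (Metric.sphere (0 : Fin (m + 1) → ℝ) 1).Nonempty :=
    (NormedSpace.sphere_nonempty (E := Fin (m + 1) → ℝ)).2 zero_le_one
  obtain ⟨c₀, hc₀, hmin⟩ := (isCompact_sphere (0 : Fin (m + 1) → ℝ) 1).exists_isMinOn hne
    hφc.continuousOn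
  have hδ : 0 < φ c₀ := hφpos c₀ (by rintro rfl; simp at hc₀)
  have hscale : ∀ (r : ℝ) c, φ (r • c) = r ^ 2 * φ c := by
    intro r c
    simp only [φ]
    rw [← intervalIntegral.integral_const_mul]
    congr 1
    funext s
    have : ev (r • c) s = r * ev c s := by
      simp only [ev, Finset.mul_sum, Pi.smul_apply, smul_eq_mul, mul_assoc]
    rw [this]; ring
  have hlow : ∀ c, φ c₀ * ‖c‖ ^ 2 ≤ φ c := by
    intro c
    rcases eq_or_ne c 0 with rfl | hc
    · have := hscale 0 0
      simp only [smul_zero] at this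
      rw [this]; simp
    · have hn : 0 < ‖c‖ := norm_pos_iff.2 hc
      have h1 := hmin (show ‖c‖⁻¹ • c ∈ Metric.sphere (0 : Fin (m + 1) → ℝ) 1 by
        simp [norm_smul, hn.ne'])
      simp only [mem_ofPred_eq] at h1
      rw [hscale] at h1
      calc φ c₀ * ‖c‖ ^ 2 ≤ (‖c‖⁻¹ ^ 2 * φ c) * ‖c‖ ^ 2 := by gcongr
        _ = φ c := by field_simp
  refine ⟨(m + 1 : ℝ) ^ 2 / φ c₀, by positivity, fun q hq => ?_⟩
  let c : Fin (m + 1) → ℝ := fun i => q.coeff i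
  have hq' : ∀ s, q.eval s = ev c s := by
    intro s
    rw [Polynomial.eval_eq_sum_range' (Nat.lt_succ_of_le hq), Finset.sum_range]
  have h1 : |q.eval 1| ≤ (m + 1) * ‖c‖ := by
    rw [hq']
    simp only [ev, one_pow, mul_one]
    calc |∑ i, c i| ≤ ∑ _i : Fin (m + 1), ‖c‖ :=
          (Finset.abs_sum_le_sum_abs _ _).trans (Finset.sum_le_sum fun i _ => norm_le_pi_norm c i)
      _ = _ := by simp
  have h2 : (∫ s in (0 : ℝ)..1, s ^ k * q.eval s ^ 2) = φ c := by
    simp only [hq', φ]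
  rw [h2, ← sq_abs, div_mul_eq_mul_div, le_div_iff₀ hδ]
  calc |q.eval 1| ^ 2 * φ c₀ ≤ ((m + 1) * ‖c‖) ^ 2 * φ c₀ := by gcongr
    _ = (m + 1) ^ 2 * (φ c₀ * ‖c‖ ^ 2) := by ring
    _ ≤ _ := by gcongr; exact hlow c

end Polynomial

/-! ### Facets of convex bodies and the discrete trace inequality -/

section Facets

variable {d : ℕ}

/-- A facet lies in a supporting hyperplane. -/
theorem IsFacet.exists_hyperplane {K F : Set (Vec d)} (hK : Convex ℝ K)
    (hKi : (interior K).Nonempty) (hF : IsFacet K F) :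
    ∃ (n : Vec d) (c : ℝ), ‖n‖ = 1 ∧ (∀ y ∈ F, ⟪n, y⟫ = c) ∧ ∀ x ∈ K, ⟪n, x⟫ ≤ c := by
  obtain ⟨hexp, ⟨y₀, hy₀⟩, hdim⟩ := hF
  obtain ⟨l, hl⟩ := hexp ⟨y₀, hy₀⟩
  have hl0 : l ≠ 0 := by
    rintro rfl
    have hFK : F = K := by rw [hl]; simp
    have h1 := (hK.interior_nonempty_iff_affineSpan_eq_top).1 hKi
    have h2 : vectorSpan ℝ F = ⊤ := by
      rw [hFK, ← direction_affineSpan, h1, AffineSubspace.direction_top]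
    rw [h2, finrank_top, finrank_euclideanSpace_fin] at hdim
    omega
  set w := (InnerProductSpace.toDual ℝ (Vec d)).symm l
  have hw : ∀ x, ⟪w, x⟫ = l x := fun x => InnerProductSpace.toDual_symm_apply
  have hw0 : 0 < ‖w‖ := by
    rw [norm_pos_iff]
    simpa [w] using hl0
  rw [hl] at hy₀
  refine ⟨‖w‖⁻¹ • w, ‖w‖⁻¹ * l y₀, by simp [norm_smul, hw0.ne'], fun y hy => ?_, fun x hx => ?_⟩
  · rw [real_inner_smul_left, hw]
    rw [hl] at hy
    rw [le_antisymm (hy₀.2 y hy.1) (hy.2 y₀ hy₀.1)]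
  · rw [real_inner_smul_left, hw]
    exact mul_le_mul_of_nonneg_left (hy₀.2 x hx) (by positivity)

theorem IsFacet.subset {K F : Set (Vec d)} (hF : IsFacet K F) : F ⊆ K := hF.1.subset

theorem IsFacet.isCompact {K F : Set (Vec d)} (hKc : IsCompact K) (hF : IsFacet K F) :
    IsCompact F := hF.1.isCompact hKc

theorem IsFacet.isFiniteMeasure {K F : Set (Vec d)} (hK : Convex ℝ K) (hKc : IsCompact K)
    (hKi : (interior K).Nonempty) (hF : IsFacet K F) :
    IsFiniteMeasure ((Measure.euclideanHausdorffMeasure (d - 1) : Measure (Vec d)).restrict F) := by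
  obtain ⟨n, c, hn, hFc, -⟩ := hF.exists_hyperplane hK hKi
  have := hF.2.2
  exact isFiniteMeasure_restrict_hyperplane hn (by rw [finrank_euclideanSpace_fin]; omega) hFc
    (hF.isCompact hKc)

theorem integrableOn_of_continuous {X E : Type*} [TopologicalSpace X] [T2Space X]
    [MeasurableSpace X] [OpensMeasurableSpace X] [SecondCountableTopology X]
    [NormedAddCommGroup E] {μ : Measure X} {s : Set X}
    [IsFiniteMeasure (μ.restrict s)] (hs : IsCompact s) {g : X → E} (hg : Continuous g) :
    IntegrableOn g s μ := by
  obtain ⟨C, hC⟩ := hs.exists_bound_of_continuousOn hg.continuousOn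
  refine Integrable.of_bound ?_ C ?_
  · exact hg.continuousOn.aestronglyMeasurable_of_isCompact hs hs.measurableSet
  · filter_upwards [self_mem_ae_restrict hs.measurableSet] with x hx using hC x hx

/-- The restriction of a polynomial to a line, parametrised affinely, is a polynomial of no larger
degree. -/
theorem exists_polynomial_eval_segment (p : MvPolynomial (Fin d) ℝ) {m : ℕ}
    (hp : p.totalDegree ≤ m) (x y : Vec d) : ∃ q : Polynomial ℝ, q.natDegree ≤ m ∧
      ∀ s, q.eval s = peval p (x + s • (y - x)) := by
  refine ⟨MvPolynomial.aeval
    (fun i => Polynomial.C (x i) + Polynomial.X * Polynomial.C (y i - x i)) p, ?_, fun s => ?_⟩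
  · have := MvPolynomial.aeval_natDegree_le (n := 1) p hp
      (fun i => Polynomial.C (x i) + Polynomial.X * Polynomial.C (y i - x i)) fun i => by
        compute_degree
    simpa using this
  · rw [peval, ← Polynomial.coe_evalRingHom, MvPolynomial.aeval_def, MvPolynomial.hom_eval₂]
    rw [← MvPolynomial.eval₂_id]
    congr 1
    · ext r; simp
    · funext i; simp

/-- Discrete trace inequality for a facet of a convex body. The cone over the facet with apex at the
centre of an inscribed ball has height at least the radius of the ball, and on each segment to the
apex a polynomial is controlled by its one-dimensional mean square. -/
theorem exists_trace_constant (d m : ℕ) : ∃ C : ℝ, 0 < C ∧ ∀ (K F : Set (Vec d)), Convex ℝ K →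
    IsCompact K → (interior K).Nonempty → IsFacet K F → ∀ (x₀ : Vec d) (ρ : ℝ), 0 < ρ →
    Metric.closedBall x₀ ρ ⊆ K → ∀ p : MvPolynomial (Fin d) ℝ, p.totalDegree ≤ m →
    ∫ x in F, peval p x ^ 2 ∂(Measure.euclideanHausdorffMeasure (d - 1))
      ≤ C / ρ * ∫ x in K, peval p x ^ 2 := by
  obtain ⟨C, hC, hCq⟩ := exists_eval_one_sq_le m (d - 1)
  refine ⟨C, hC, fun K F hK hKc hKi hF x₀ ρ hρ hball p hp => ?_⟩
  have hd := hF.2.2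
  obtain ⟨n, c, hn, hFc, hKn⟩ := hF.exists_hyperplane hK hKi
  have hfin := hF.isFiniteMeasure hK hKc hKi
  have hFcomp := hF.isCompact hKc
  set ν := (Measure.euclideanHausdorffMeasure (d - 1) : Measure (Vec d)).restrict F
  have hρh : ρ ≤ c - ⟪n, x₀⟫ := by
    have h1 := hKn (x₀ + ρ • n) (hball (by
      simp [norm_smul, hn, abs_of_pos hρ]))
    rw [inner_add_right, real_inner_smul_right, real_inner_self_eq_norm_sq, hn] at h1
    linarith
  have hh : 0 < c - ⟪n, x₀⟫ := hρ.trans_le hρh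
  have hpc := continuous_peval p
  have hcone := integral_cone_le hn (k := d - 1) (by rw [finrank_euclideanSpace_fin]; omega) hK hKc
    hF.subset hFcomp hFc (hball (Metric.mem_closedBall_self hρ.le)) hh (by ring)
    (g := fun x => peval p x ^ 2) (hpc.pow 2) (fun x => sq_nonneg _)
  set I := ∫ x in K, peval p x ^ 2
  let f : Vec d → ℝ → ℝ := fun y s => s ^ (d - 1) * peval p (x₀ + s • (y - x₀)) ^ 2
  have hf : Continuous (Function.uncurry f) := by
    simp only [f, Function.uncurry_def]
    have : Continuous fun q : Vec d × ℝ => peval p (x₀ + q.2 • (q.1 - x₀)) := hpc.comp (by fun_prop)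
    fun_prop
  have hfin1 : IsFiniteMeasure (volume.restrict (Ioc (0 : ℝ) 1)) := ⟨by simp⟩
  have hfy : ∀ y, Continuous (f y) := fun y => hf.comp (Continuous.prodMk_right y)
  have hf0 : ∀ y, ∀ s ∈ Ioc (0 : ℝ) 1, 0 ≤ f y s := fun y s hs =>
    mul_nonneg (pow_nonneg hs.1.le _) (sq_nonneg _)
  have hGc : Continuous fun y => ∫ s in (0 : ℝ)..1, f y s :=
    intervalIntegral.continuous_parametric_intervalIntegral_of_continuous' hf 0 1
  have hint : Integrable (Function.uncurry f) (ν.prod (volume.restrict (Ioc (0 : ℝ) 1))) := by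
    rw [integrable_prod_iff hf.aestronglyMeasurable]
    refine ⟨Filter.Eventually.of_forall fun y => (hfy y).integrableOn_Ioc, ?_⟩
    have h1 : (fun y => ∫ s, ‖Function.uncurry f (y, s)‖ ∂(volume.restrict (Ioc (0 : ℝ) 1)))
        = fun y => ∫ s in (0 : ℝ)..1, f y s := by
      funext y
      rw [intervalIntegral.integral_of_le zero_le_one]
      refine setIntegral_congr_fun measurableSet_Ioc fun s hs => ?_
      exact abs_of_nonneg (hf0 y s hs)
    rw [h1]
    exact integrableOn_of_continuous hFcomp hGc
  have hswap : ∫ y, (∫ s in (0 : ℝ)..1, f y s) ∂ν = ∫ s in (0 : ℝ)..1, ∫ y, f y s ∂ν := by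
    simp only [intervalIntegral.integral_of_le zero_le_one]
    exact integral_integral_swap hint
  have hpoint : ∀ y, peval p y ^ 2 ≤ C * ∫ s in (0 : ℝ)..1, f y s := by
    intro y
    obtain ⟨q, hq, hqe⟩ := exists_polynomial_eval_segment p hp x₀ y
    have h1 := hCq q hq
    simp only [hqe, one_smul, add_sub_cancel] at h1
    exact h1
  have hcone' : (c - ⟪n, x₀⟫) * ∫ s in (0 : ℝ)..1, ∫ y, f y s ∂ν ≤ I := by
    simpa only [f, integral_const_mul] using hcone
  calc ∫ x, peval p x ^ 2 ∂ν ≤ ∫ y, C * (∫ s in (0 : ℝ)..1, f y s) ∂ν :=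
        integral_mono (integrableOn_of_continuous hFcomp (hpc.pow 2))
          (integrableOn_of_continuous hFcomp (continuous_const.mul hGc)) hpoint
    _ = C * ∫ s in (0 : ℝ)..1, ∫ y, f y s ∂ν := by rw [integral_const_mul, hswap]
    _ ≤ C * (I / ρ) := by
        gcongr
        rw [le_div_iff₀ hρ, mul_comm]
        refine le_trans ?_ hcone'
        gcongr
        refine intervalIntegral.integral_nonneg zero_le_one fun s hs => ?_
        exact integral_nonneg fun y => mul_nonneg (pow_nonneg hs.1 _) (sq_nonneg _)
    _ = _ := by ring

end Facets

/-! ### Calculus of polynomial fields, and elementary facts on meshes -/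

section Poly

variable {d : ℕ}

theorem peval_add (p q : MvPolynomial (Fin d) ℝ) (x : Vec d) :
    peval (p + q) x = peval p x + peval q x := by simp [peval]

theorem peval_smul (c : ℝ) (p : MvPolynomial (Fin d) ℝ) (x : Vec d) :
    peval (c • p) x = c * peval p x := by simp [peval]

theorem contDiff_peval (p : MvPolynomial (Fin d) ℝ) : ContDiff ℝ ∞ (peval p) := by
  induction p using MvPolynomial.induction_on with
  | C a =>
    have : peval (MvPolynomial.C a : MvPolynomial (Fin d) ℝ) = fun _ => a :=
      funext fun x => by simp [peval]
    rw [this]; exact contDiff_const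
  | add p q hp hq =>
    have : peval (p + q) = fun x => peval p x + peval q x := funext fun x => peval_add p q x
    rw [this]; exact hp.add hq
  | mul_X p i hp =>
    have : peval (p * MvPolynomial.X i) = fun x => peval p x * x i :=
      funext fun x => by simp [peval]
    rw [this]
    exact hp.mul (EuclideanSpace.proj (𝕜 := ℝ) i).contDiff

theorem hasFDerivAt_peval (p : MvPolynomial (Fin d) ℝ) (x : Vec d) :
    HasFDerivAt (peval p)
      (∑ j, peval (MvPolynomial.pderiv j p) x • (EuclideanSpace.proj j : Vec d →L[ℝ] ℝ)) x := by
  induction p using MvPolynomial.induction_on with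
  | C a =>
    have : peval (MvPolynomial.C a : MvPolynomial (Fin d) ℝ) = fun _ => a :=
      funext fun x => by simp [peval]
    rw [this]
    simpa [peval] using hasFDerivAt_const (𝕜 := ℝ) a x
  | add p q hp hq =>
    have : peval (p + q) = fun x => peval p x + peval q x := funext fun x => peval_add p q x
    rw [this]
    convert! hp.add hq using 1
    simp [peval_add, add_smul, Finset.sum_add_distrib]
  | mul_X p i hp =>
    have : peval (p * MvPolynomial.X i) = fun x => peval p x * x i :=
      funext fun x => by simp [peval]
    rw [this]
    convert! hp.mul (EuclideanSpace.proj (𝕜 := ℝ) i : Vec d →L[ℝ] ℝ).hasFDerivAt using 1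
    ext w
    simp [peval, Derivation.leibniz, MvPolynomial.pderiv_X, Pi.single_apply, add_mul,
      Finset.sum_add_distrib, Finset.mul_sum, apply_ite]
    exact Finset.sum_congr rfl fun j _ => by ring

theorem inner_gradient_peval (p : MvPolynomial (Fin d) ℝ) (b x : Vec d) :
    ⟪b, ∇ (peval p) x⟫ = ∑ j, peval (MvPolynomial.pderiv j p) x * b j := by
  rw [real_inner_comm, gradient, InnerProductSpace.toDual_symm_apply,
    (hasFDerivAt_peval p x).fderiv]
  simp

/-- Half the square of the modulus of a polynomial field, as a polynomial. -/
noncomputable def halfSq (v : PolyField d) : MvPolynomial (Fin d) ℝ := (1 / 2 : ℝ) • ∑ i, v i * v i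

theorem peval_halfSq (v : PolyField d) (x : Vec d) :
    peval (halfSq v) x = 1 / 2 * ‖val v x‖ ^ 2 := by
  rw [halfSq, peval_smul, EuclideanSpace.norm_sq_eq]
  simp [peval, val, sq]

/-- `b · ∇(|v|² / 2) = (b · ∇)v · v`. -/
theorem inner_gradient_halfSq (v : PolyField d) (b x : Vec d) :
    ⟪b, ∇ (peval (halfSq v)) x⟫ = ⟪dirDeriv v b x, val v x⟫ := by
  rw [inner_gradient_peval]
  simp only [halfSq, PiLp.inner_apply, dirDeriv, val, Matrix.mulVec, dotProduct, jac]
  simp [peval, Derivation.leibniz, Finset.sum_mul, Finset.mul_sum]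
  rw [Finset.sum_comm]
  refine Finset.sum_congr rfl fun i _ => Finset.sum_congr rfl fun j _ => by ring

theorem eq_zero_of_peval_eq_zero {p : MvPolynomial (Fin d) ℝ} {U : Set (Vec d)} (hU : IsOpen U)
    (hne : U.Nonempty) (h : ∀ x ∈ U, peval p x = 0) : p = 0 := by
  obtain ⟨x, hx⟩ := hne
  have hU' : IsOpen ((WithLp.toLp 2 : (Fin d → ℝ) → Vec d) ⁻¹' U) :=
    hU.preimage (PiLp.continuous_toLp 2 _)
  obtain ⟨ε, hε, hball⟩ := Metric.isOpen_iff.1 hU' (fun i => x i) (by simpa using hx)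
  rw [ball_pi _ hε] at hball
  refine MvPolynomial.funext_set (fun i => Metric.ball (x i) ε) (fun i => ?_) fun y hy => ?_
  · rw [Real.ball_eq_Ioo]
    exact Ioo_infinite (by linarith)
  · have := h _ (hball hy)
    simpa [peval] using this

end Poly

section MeshFacts

variable {d : ℕ} (M : Mesh d)

theorem Mesh.convex (K : M.elems) : Convex ℝ K.1 := by
  obtain ⟨s, hs⟩ := M.polytope K.1 K.2
  rw [hs]; exact convex_convexHull ℝ _

theorem Mesh.isCompact (K : M.elems) : IsCompact K.1 := by
  obtain ⟨s, hs⟩ := M.polytope K.1 K.2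
  rw [hs]; exact s.finite_toSet.isCompact_convexHull (𝕜 := ℝ)

theorem Mesh.interior_subset_domain (K : M.elems) : interior K.1 ⊆ M.Ω := by
  rw [M.domain_eq]
  exact interior_mono (subset_biUnion_of_mem (u := fun K : Set (Vec d) => K) K.2)

theorem Mesh.restrict_interior (K : M.elems) :
    (volume : Measure (Vec d)).restrict (interior K.1) = volume.restrict K.1 :=
  Measure.restrict_congr_set (interior_ae_eq_of_null_frontier ((M.convex K).addHaar_frontier _))

theorem Mesh.restrict_le (K : M.elems) :
    (volume : Measure (Vec d)).restrict K.1 ≤ volume.restrict M.Ω := by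
  rw [← M.restrict_interior K]
  exact Measure.restrict_mono_set _ (M.interior_subset_domain K)

theorem Mesh.facet_isCompact (F : M.facets) : IsCompact F.1 :=
  (M.pos_facet F).isCompact (M.isCompact _)

instance (F : M.facets) : IsFiniteMeasure (facetMeasure M F) :=
  (M.pos_facet F).isFiniteMeasure (M.convex _) (M.isCompact _) (M.interior_nonempty _ (M.pos F).2)

instance (K : M.elems) : IsFiniteMeasure ((volume : Measure (Vec d)).restrict K.1) :=
  ⟨by simpa using (M.isCompact K).measure_lt_top⟩

instance : IsFiniteMeasure ((volume : Measure (Vec d)).restrict M.Ω) :=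
  ⟨by simpa using M.isBounded.measure_lt_top⟩

theorem Mesh.integrable_facet {E : Type*} [NormedAddCommGroup E] (F : M.facets) {g : Vec d → E}
    (hg : Continuous g) : Integrable g (facetMeasure M F) := by
  have : IsFiniteMeasure
    ((Measure.euclideanHausdorffMeasure (d - 1) : Measure (Vec d)).restrict F.1) :=
    inferInstanceAs (IsFiniteMeasure (facetMeasure M F))
  exact integrableOn_of_continuous (M.facet_isCompact F) hg

theorem Mesh.integrable_elem {E : Type*} [NormedAddCommGroup E] (K : M.elems) {g : Vec d → E}
    (hg : Continuous g) : IntegrableOn g K.1 :=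
  hg.continuousOn.integrableOn_compact (M.isCompact K)

theorem Mesh.diam_pos (hd : 0 < d) (K : M.elems) : 0 < Metric.diam K.1 := by
  obtain ⟨x, hx⟩ := M.interior_nonempty K.1 K.2
  obtain ⟨ε, hε, hball⟩ := Metric.isOpen_iff.1 isOpen_interior x hx
  have : Nontrivial (Vec d) := by
    have : Nonempty (Fin d) := ⟨⟨0, hd⟩⟩
    infer_instance
  have h1 : (Metric.ball x ε).Nontrivial := by
    obtain ⟨v, hv⟩ := exists_norm_eq (Vec d) (c := ε / 2) (by positivity)
    refine ⟨x, Metric.mem_ball_self hε, x + v, by simp [hv]; linarith, fun h => ?_⟩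
    have : v = 0 := by simpa using h
    rw [this, norm_zero] at hv
    linarith
  exact Metric.diam_pos (h1.mono (hball.trans interior_subset)) (M.isCompact K).isBounded

end MeshFacts

/-! ### The discrete spaces as finite-dimensional linear spaces -/

section Spaces

variable {d : ℕ} (M : Mesh d)

theorem val_add (v w : PolyField d) (x : Vec d) : val (v + w) x = val v x + val w x := by
  ext i; simp [val, peval]

theorem val_smul (c : ℝ) (v : PolyField d) (x : Vec d) : val (c • v) x = c • val v x := by
  ext i; simp [val, peval]

theorem glue_add {G : Type*} [AddCommMonoid G] (g h : M.elems → Vec d → G) :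
    glue M (fun K x => g K x + h K x) = fun x => glue M g x + glue M h x := by
  funext x
  simp only [glue, ← Finset.sum_add_distrib]
  refine Finset.sum_congr rfl fun K _ => ?_
  exact congrFun (indicator_add _ (g K) (h K)) x

theorem glue_smul {G : Type*} [AddCommGroup G] [Module ℝ G] (c : ℝ) (g : M.elems → Vec d → G) :
    glue M (fun K x => c • g K x) = fun x => c • glue M g x := by
  funext x
  simp only [glue, Finset.smul_sum]
  refine Finset.sum_congr rfl fun K _ => ?_
  exact indicator_const_smul_apply _ _ _ _

theorem glue_of_mem {G : Type*} [AddCommMonoid G] (g : M.elems → Vec d → G) (K : M.elems)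
    {x : Vec d} (hx : x ∈ interior K.1) : glue M g x = g K x := by
  rw [glue, Finset.sum_eq_single K, indicator_of_mem hx]
  · intro K' _ hne
    refine indicator_of_notMem (fun hx' => ?_) _
    exact (M.interior_disjoint K'.1 K'.2 K.1 K.2 (fun h => hne (Subtype.ext h))).le_bot ⟨hx', hx⟩
  · intro h; exact absurd (Finset.mem_univ K) h

/-- `toL2` as a linear map. -/
noncomputable def toL2Lin : BrokenField M →ₗ[ℝ] L2Vec M where
  toFun := toL2 M
  map_add' v w := by
    rw [toL2, toL2, toL2, ← MemLp.toLp_add]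
    refine MemLp.toLp_congr _ _ (Filter.Eventually.of_forall fun x => ?_)
    have := congrFun (glue_add M (fun K => val (v K)) (fun K => val (w K))) x
    simp only [← val_add] at this
    exact this
  map_smul' c v := by
    rw [toL2, toL2, RingHom.id_apply, ← MemLp.toLp_const_smul]
    refine MemLp.toLp_congr _ _ (Filter.Eventually.of_forall fun x => ?_)
    have := congrFun (glue_smul M c (fun K => val (v K))) x
    simp only [← val_smul] at this
    exact this

/-- `toL2s` as a linear map. -/
noncomputable def toL2sLin : BrokenScalar M →ₗ[ℝ] L2Scal M where
  toFun := toL2s M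
  map_add' v w := by
    rw [toL2s, toL2s, toL2s, ← MemLp.toLp_add]
    refine MemLp.toLp_congr _ _ (Filter.Eventually.of_forall fun x => ?_)
    have := congrFun (glue_add M (fun K => peval (v K)) (fun K => peval (w K))) x
    simp only [← peval_add] at this
    exact this
  map_smul' c v := by
    rw [toL2s, toL2s, RingHom.id_apply, ← MemLp.toLp_const_smul]
    refine MemLp.toLp_congr _ _ (Filter.Eventually.of_forall fun x => ?_)
    have := congrFun (glue_smul M c (fun K => peval (v K))) x
    simp only [smul_eq_mul, ← peval_smul] at this
    exact this

theorem toL2_apply (v : BrokenField M) : toL2Lin M v = toL2 M v := rfl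

/-- A broken polynomial is determined by its values almost everywhere. -/
theorem toL2Lin_injective : Function.Injective (toL2Lin M) := by
  rw [injective_iff_map_eq_zero]
  intro v hv
  have h1 : glue M (fun K => val (v K)) =ᵐ[volume.restrict M.Ω] 0 := by
    have h2 := MemLp.coeFn_toLp (memLp_glue M (fun K => val (v K)) fun K => continuous_val (v K))
    have h3 : toL2 M v = 0 := hv
    rw [toL2] at h3
    rw [h3] at h2
    exact h2.symm.trans (Lp.coeFn_zero _ _ _)
  funext K i
  refine eq_zero_of_peval_eq_zero isOpen_interior (M.interior_nonempty K.1 K.2) fun x hx => ?_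
  have h2 := ae_restrict_of_ae_restrict_of_subset (M.interior_subset_domain K) h1
  have h3 : val (v K) =ᵐ[volume.restrict (interior K.1)] 0 := by
    filter_upwards [h2, self_mem_ae_restrict isOpen_interior.measurableSet] with y hy hyK
    rw [← hy, glue_of_mem M _ K hyK]
  have h4 := Measure.eqOn_open_of_ae_eq h3 isOpen_interior (continuous_val (v K)).continuousOn
    continuousOn_const hx
  have h5 := congrArg (fun z : Vec d => z i) h4
  exact h5

/-- The gradient of a test function is continuous and bounded. -/
theorem exists_bound_gradient {φ : Vec d → ℝ} (hφ : ContDiff ℝ ∞ φ) (hc : HasCompactSupport φ) :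
    Continuous (∇ φ) ∧ ∃ C, ∀ x, ‖∇ φ x‖ ≤ C := by
  have h1 : Continuous (fderiv ℝ φ) := hφ.continuous_fderiv (by simp)
  obtain ⟨C, hC⟩ := (hc.fderiv (𝕜 := ℝ)).exists_bound_of_continuous h1
  refine ⟨(InnerProductSpace.toDual ℝ (Vec d)).symm.continuous.comp h1, C, fun x => ?_⟩
  rw [gradient, LinearIsometryEquiv.norm_map]
  exact hC x

theorem integrable_inner_gradient {φ : Vec d → ℝ} (hφ : ContDiff ℝ ∞ φ)
    (hc : HasCompactSupport φ) {w : Vec d → Vec d} (hw : MemLp w 2 (volume.restrict M.Ω)) :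
    Integrable (fun x => ⟪w x, ∇ φ x⟫) (volume.restrict M.Ω) := by
  obtain ⟨h1, C, hC⟩ := exists_bound_gradient hφ hc
  refine Integrable.mono' ((hw.integrable one_le_two).norm.mul_const C)
    (hw.aestronglyMeasurable.inner h1.aestronglyMeasurable)
    (Filter.Eventually.of_forall fun x => ?_)
  exact (norm_inner_le_norm _ _).trans (by gcongr; exact hC x)

theorem integrable_mul_test {φ : Vec d → ℝ} (hφ : ContDiff ℝ ∞ φ)
    (hc : HasCompactSupport φ) {g : Vec d → ℝ} (hg : MemLp g 2 (volume.restrict M.Ω)) :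
    Integrable (fun x => g x * φ x) (volume.restrict M.Ω) := by
  obtain ⟨C, hC⟩ := hc.exists_bound_of_continuous hφ.continuous
  refine Integrable.mono' ((hg.integrable one_le_two).norm.mul_const C)
    (hg.aestronglyMeasurable.mul hφ.continuous.aestronglyMeasurable)
    (Filter.Eventually.of_forall fun x => ?_)
  rw [norm_mul]
  gcongr
  exact hC x

theorem memHdiv_add {v w : Vec d → Vec d} (hv : MemHdiv M.Ω v) (hw : MemHdiv M.Ω w) :
    MemHdiv M.Ω (fun x => v x + w x) := by
  obtain ⟨hv1, g, hg1, hg⟩ := hv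
  obtain ⟨hw1, h, hh1, hh⟩ := hw
  refine ⟨hv1.add hw1, fun x => g x + h x, hg1.add hh1, fun φ hφ hc hs => ?_⟩
  simp only [inner_add_left, add_mul]
  rw [integral_add (integrable_inner_gradient M hφ hc hv1) (integrable_inner_gradient M hφ hc hw1),
    integral_add (integrable_mul_test M hφ hc hg1) (integrable_mul_test M hφ hc hh1),
    hg φ hφ hc hs, hh φ hφ hc hs]
  ring

theorem memHdiv_smul {v : Vec d → Vec d} (c : ℝ) (hv : MemHdiv M.Ω v) :
    MemHdiv M.Ω (fun x => c • v x) := by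
  obtain ⟨hv1, g, hg1, hg⟩ := hv
  refine ⟨hv1.const_smul c, fun x => c • g x, hg1.const_smul c, fun φ hφ hc hs => ?_⟩
  simp only [real_inner_smul_left, smul_eq_mul, mul_assoc]
  rw [integral_const_mul, integral_const_mul, hg φ hφ hc hs]
  ring

/-- The velocity space `V_h` as a linear space. -/
def velocitySpace (Vloc : M.elems → Submodule ℝ (PolyField d)) : Submodule ℝ (BrokenField M) where
  carrier := Vh M Vloc
  add_mem' := by
    rintro v w ⟨hv1, hv2, hv3⟩ ⟨hw1, hw2, hw3⟩
    refine ⟨fun K => (Vloc K).add_mem (hv1 K) (hw1 K), ?_, fun F hF x hx => ?_⟩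
    · have := memHdiv_add M hv2 hw2
      rw [← glue_add] at this
      simp only [← val_add] at this
      exact this
    · rw [Pi.add_apply, val_add, inner_add_left, hv3 F hF x hx, hw3 F hF x hx, add_zero]
  zero_mem' := by
    refine ⟨fun K => (Vloc K).zero_mem, ?_, fun F _ x _ => ?_⟩
    · have h0 : glue M (fun K => val ((0 : BrokenField M) K)) = fun _ => 0 := by
        funext x
        refine Finset.sum_eq_zero fun K _ => ?_
        have : val ((0 : BrokenField M) K) = fun _ => 0 := by
          funext y; ext i; simp [val, peval]
        simp only [this, indicator_zero]
      rw [h0]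
      exact ⟨MemLp.zero', fun _ => 0, MemLp.zero', fun φ _ _ _ => by simp⟩
    · have : val ((0 : BrokenField M) (M.pos F)) x = 0 := by
        ext i; simp [val, peval]
      rw [this, inner_zero_left]
  smul_mem' := by
    rintro c v ⟨hv1, hv2, hv3⟩
    refine ⟨fun K => (Vloc K).smul_mem c (hv1 K), ?_, fun F hF x hx => ?_⟩
    · have := memHdiv_smul M c hv2
      rw [← glue_smul] at this
      simp only [← val_smul] at this
      exact this
    · rw [Pi.smul_apply, val_smul, real_inner_smul_left, hv3 F hF x hx, mul_zero]

/-- The pressure space `Q_h` as a linear space. -/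
def pressureSpace (Qloc : M.elems → Submodule ℝ (MvPolynomial (Fin d) ℝ)) :
    Submodule ℝ (BrokenScalar M) where
  carrier := Qh M Qloc
  add_mem' := by
    rintro p q ⟨hp1, hp2⟩ ⟨hq1, hq2⟩
    refine ⟨fun K => (Qloc K).add_mem (hp1 K) (hq1 K), ?_⟩
    have : ∀ K : M.elems, ∫ x in K.1, peval ((p + q) K) x
        = (∫ x in K.1, peval (p K) x) + ∫ x in K.1, peval (q K) x := fun K => by
      rw [← integral_add (M.integrable_elem K (continuous_peval _))
        (M.integrable_elem K (continuous_peval _))]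
      simp only [Pi.add_apply, peval_add]
    rw [Finset.sum_congr rfl fun K _ => this K, Finset.sum_add_distrib, hp2, hq2, add_zero]
  zero_mem' := ⟨fun K => (Qloc K).zero_mem, by simp [peval]⟩
  smul_mem' := by
    rintro c p ⟨hp1, hp2⟩
    refine ⟨fun K => (Qloc K).smul_mem c (hp1 K), ?_⟩
    simp only [Pi.smul_apply, peval_smul, integral_const_mul]
    rw [← Finset.mul_sum, hp2, mul_zero]

variable {M}

theorem finiteDimensional_velocitySpace {Vloc : M.elems → Submodule ℝ (PolyField d)} {m : ℕ}
    (hV : ∀ K, ∀ v ∈ Vloc K, ∀ i, (v i).totalDegree ≤ m) :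
    FiniteDimensional ℝ (velocitySpace M Vloc) := by
  let P := MvPolynomial.restrictTotalDegree (Fin d) ℝ m
  let ι : velocitySpace M Vloc →ₗ[ℝ] (M.elems → Fin d → P) :=
    { toFun := fun v K i =>
        ⟨v.1 K i, (MvPolynomial.mem_restrictTotalDegree _ _ _).2 (hV K _ (v.2.1 K) i)⟩
      map_add' := fun v w => rfl
      map_smul' := fun c v => rfl }
  refine Module.Finite.of_injective ι fun v w h => Subtype.ext ?_
  funext K i
  exact congrArg Subtype.val (congrFun (congrFun h K) i)

theorem finiteDimensional_pressureSpace
    {Qloc : M.elems → Submodule ℝ (MvPolynomial (Fin d) ℝ)} {m : ℕ}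
    (hQ : ∀ K, ∀ q ∈ Qloc K, q.totalDegree ≤ m) :
    FiniteDimensional ℝ (pressureSpace M Qloc) := by
  let P := MvPolynomial.restrictTotalDegree (Fin d) ℝ m
  let ι : pressureSpace M Qloc →ₗ[ℝ] (M.elems → P) :=
    { toFun := fun q K =>
        ⟨q.1 K, (MvPolynomial.mem_restrictTotalDegree _ _ _).2 (hQ K _ (q.2.1 K))⟩
      map_add' := fun v w => rfl
      map_smul' := fun c v => rfl }
  refine Module.Finite.of_injective ι fun v w h => Subtype.ext ?_
  funext K
  exact congrArg Subtype.val (congrFun h K)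

end Spaces

/-! ### The discrete forms as bilinear maps, and the energy identity of the convection form -/

/-- The bilinear form obtained by integrating a family of bilinear forms. -/
noncomputable def integralBilin {X V W : Type*} [MeasurableSpace X] [AddCommGroup V] [Module ℝ V]
    [AddCommGroup W] [Module ℝ W] (μ : Measure X) (φ : X → V →ₗ[ℝ] W →ₗ[ℝ] ℝ)
    (h : ∀ v w, Integrable (fun x => φ x v w) μ) : V →ₗ[ℝ] W →ₗ[ℝ] ℝ :=
  LinearMap.mk₂ ℝ (fun v w => ∫ x, φ x v w ∂μ)
    (fun v v' w => by
      simp only [map_add, LinearMap.add_apply]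
      exact integral_add (h v w) (h v' w))
    (fun c v w => by
      simp only [map_smul, LinearMap.smul_apply, smul_eq_mul]
      exact integral_const_mul _ _)
    (fun v w w' => by
      simp only [map_add]
      exact integral_add (h v w) (h v w'))
    (fun c v w => by
      simp only [map_smul, smul_eq_mul]
      exact integral_const_mul _ _)

theorem integralBilin_apply {X V W : Type*} [MeasurableSpace X] [AddCommGroup V] [Module ℝ V]
    [AddCommGroup W] [Module ℝ W] (μ : Measure X) (φ : X → V →ₗ[ℝ] W →ₗ[ℝ] ℝ)
    (h : ∀ v w, Integrable (fun x => φ x v w) μ) (v : V) (w : W) :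
    integralBilin μ φ h v w = ∫ x, φ x v w ∂μ := rfl

section Traces

variable {d : ℕ} (M : Mesh d)

theorem jac_add (v w : PolyField d) (x : Vec d) : jac (v + w) x = jac v x + jac w x := by
  ext i j; simp [jac, peval]

theorem jac_smul (c : ℝ) (v : PolyField d) (x : Vec d) : jac (c • v) x = c • jac v x := by
  ext i j; simp [jac, peval]

theorem dirDeriv_add (v w : PolyField d) (b x : Vec d) :
    dirDeriv (v + w) b x = dirDeriv v b x + dirDeriv w b x := by
  simp only [dirDeriv, jac_add, Matrix.add_mulVec, WithLp.toLp_add]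

theorem dirDeriv_smul (c : ℝ) (v : PolyField d) (b x : Vec d) :
    dirDeriv (c • v) b x = c • dirDeriv v b x := by
  simp only [dirDeriv, jac_smul, Matrix.smul_mulVec, WithLp.toLp_smul]

theorem divg_add (v w : PolyField d) (x : Vec d) : divg (v + w) x = divg v x + divg w x := by
  simp [divg, jac_add, Finset.sum_add_distrib]

theorem divg_smul (c : ℝ) (v : PolyField d) (x : Vec d) : divg (c • v) x = c * divg v x := by
  simp [divg, jac_smul, Finset.mul_sum]

theorem continuous_jac (v : PolyField d) (i j : Fin d) : Continuous fun x => jac v x i j :=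
  continuous_peval _

theorem continuous_divg (v : PolyField d) : Continuous (divg v) := by
  unfold divg
  exact continuous_finsetSum _ fun i _ => continuous_jac v i i

theorem continuous_dirDeriv_uncurry (v : PolyField d) :
    Continuous fun q : Vec d × Vec d => dirDeriv v q.1 q.2 := by
  have h1 : Continuous fun q : Vec d × Vec d => fun i => ∑ j, jac v q.2 i j * q.1 j := by
    refine continuous_pi fun i => continuous_finsetSum _ fun j _ => ?_
    have h2 : Continuous fun q : Vec d × Vec d => q.1 j := by fun_prop
    exact ((continuous_jac v i j).comp continuous_snd).mul h2
  exact (PiLp.continuous_toLp 2 _).comp h1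

theorem continuous_dirDeriv (v : PolyField d) (b : Vec d) :
    Continuous fun x => dirDeriv v b x := by
  have h : Continuous fun x : Vec d => (b, x) := continuous_const.prodMk continuous_id
  have h' := (continuous_dirDeriv_uncurry v).comp h
  simpa only [Function.comp_def] using h'

theorem continuous_jump {g : M.elems → Vec d → Vec d} (hg : ∀ K, Continuous (g K))
    (F : M.facets) : Continuous (jump M g F) := by
  unfold jump
  split_ifs
  · exact (hg _).sub (hg _)
  · exact hg _

theorem continuous_avg {g : M.elems → Vec d → Vec d} (hg : ∀ K, Continuous (g K))
    (F : M.facets) : Continuous (avg M g F) := by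
  unfold avg
  split_ifs
  · exact ((hg _).add (hg _)).const_smul (1 / 2 : ℝ)
  · exact hg _

theorem continuous_vjump (v : BrokenField M) (F : M.facets) : Continuous (vjump M v F) :=
  continuous_jump M (fun K => continuous_val (v K)) F

theorem continuous_vavg (v : BrokenField M) (F : M.facets) :
    Continuous (avg M (fun K => val (v K)) F) :=
  continuous_avg M (fun K => continuous_val (v K)) F

theorem continuous_gradNormalAvg (v : BrokenField M) (F : M.facets) :
    Continuous (gradNormalAvg M v F) :=
  continuous_avg M (fun K => continuous_dirDeriv (v K) (M.normal F)) F

/-- The value on the element `K`, as a linear map in the broken field. -/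
noncomputable def valLin (K : M.elems) (x : Vec d) : BrokenField M →ₗ[ℝ] Vec d where
  toFun v := val (v K) x
  map_add' v w := val_add (v K) (w K) x
  map_smul' c v := val_smul c (v K) x

/-- An entry of the Jacobian matrix on the element `K`, as a linear map in the broken field. -/
noncomputable def jacLin (K : M.elems) (i j : Fin d) (x : Vec d) : BrokenField M →ₗ[ℝ] ℝ where
  toFun v := jac (v K) x i j
  map_add' v w := by simp [jac_add]
  map_smul' c v := by simp [jac_smul]

/-- The directional derivative on the element `K`, as a linear map in the broken field. -/
noncomputable def dirDerivLin (K : M.elems) (b x : Vec d) : BrokenField M →ₗ[ℝ] Vec d where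
  toFun v := dirDeriv (v K) b x
  map_add' v w := dirDeriv_add (v K) (w K) b x
  map_smul' c v := dirDeriv_smul c (v K) b x

/-- The jump across a facet, as a linear map in the broken field. -/
noncomputable def vjumpLin (F : M.facets) (x : Vec d) : BrokenField M →ₗ[ℝ] Vec d where
  toFun v := vjump M v F x
  map_add' v w := by
    simp only [vjump, jump, Pi.add_apply, val_add]
    split_ifs
    · abel
    · rfl
  map_smul' c v := by
    simp only [vjump, jump, Pi.smul_apply, val_smul, RingHom.id_apply]
    split_ifs
    · module
    · rfl

/-- The average on a facet, as a linear map in the broken field. -/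
noncomputable def vavgLin (F : M.facets) (x : Vec d) : BrokenField M →ₗ[ℝ] Vec d where
  toFun v := avg M (fun K => val (v K)) F x
  map_add' v w := by
    simp only [avg, Pi.add_apply, val_add]
    split_ifs
    · module
    · rfl
  map_smul' c v := by
    simp only [avg, Pi.smul_apply, val_smul, RingHom.id_apply]
    split_ifs
    · module
    · rfl

/-- The averaged normal derivative on a facet, as a linear map in the broken field. -/
noncomputable def gradNormalAvgLin (F : M.facets) (x : Vec d) : BrokenField M →ₗ[ℝ] Vec d where
  toFun v := gradNormalAvg M v F x
  map_add' v w := by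
    simp only [gradNormalAvg, avg, Pi.add_apply, dirDeriv_add]
    split_ifs
    · module
    · rfl
  map_smul' c v := by
    simp only [gradNormalAvg, avg, Pi.smul_apply, dirDeriv_smul, RingHom.id_apply]
    split_ifs
    · module
    · rfl

/-- The bilinear form `(v, w) ↦ ⟪A v, B w⟫`. -/
noncomputable def innerComp {V W : Type*} [AddCommGroup V] [Module ℝ V] [AddCommGroup W]
    [Module ℝ W] (A : V →ₗ[ℝ] Vec d) (B : W →ₗ[ℝ] Vec d) : V →ₗ[ℝ] W →ₗ[ℝ] ℝ :=
  (innerₗ (Vec d)).compl₁₂ A B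

theorem innerComp_apply {V W : Type*} [AddCommGroup V] [Module ℝ V] [AddCommGroup W]
    [Module ℝ W] (A : V →ₗ[ℝ] Vec d) (B : W →ₗ[ℝ] Vec d) (v : V) (w : W) :
    innerComp A B v w = ⟪A v, B w⟫ := rfl

end Traces

section Forms

variable {d : ℕ} (M : Mesh d)

/-- The form `∑_K ∫_K ∇w : ∇v`. -/
noncomputable def gradForm : BrokenField M →ₗ[ℝ] BrokenField M →ₗ[ℝ] ℝ :=
  ∑ K : M.elems, integralBilin (volume.restrict K.1)
    (fun x => ∑ i, ∑ j, (LinearMap.mul ℝ ℝ).compl₁₂ (jacLin M K i j x) (jacLin M K i j x))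
    fun v w => by
      simp only [LinearMap.sum_apply, LinearMap.compl₁₂_apply, LinearMap.mul_apply']
      exact M.integrable_elem K (continuous_finsetSum _ fun i _ => continuous_finsetSum _ fun j _ =>
        (continuous_jac (v K) i j).mul (continuous_jac (w K) i j))

theorem gradForm_apply (w v : BrokenField M) :
    gradForm M w v = ∑ K : M.elems, ∫ x in K.1, ∑ i, ∑ j, jac (w K) x i j * jac (v K) x i j := by
  simp only [gradForm, LinearMap.sum_apply, integralBilin_apply, LinearMap.compl₁₂_apply,
    LinearMap.mul_apply']
  rfl

/-- The consistency form `∑_F ∫_F {{∇w}} n_F · [[v]]`. -/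
noncomputable def consForm : BrokenField M →ₗ[ℝ] BrokenField M →ₗ[ℝ] ℝ :=
  ∑ F : M.facets, integralBilin (facetMeasure M F)
    (fun x => innerComp (gradNormalAvgLin M F x) (vjumpLin M F x))
    fun v w => M.integrable_facet F
      ((continuous_gradNormalAvg M v F).inner (continuous_vjump M w F))

theorem consForm_apply (w v : BrokenField M) :
    consForm M w v = ∑ F, ∫ x, ⟪gradNormalAvg M w F x, vjump M v F x⟫ ∂(facetMeasure M F) := by
  simp only [consForm, LinearMap.sum_apply, integralBilin_apply, innerComp_apply]
  rfl

/-- The penalty form `∑_F ∫_F (σ / h_F) [[w]] · [[v]]`. -/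
noncomputable def penaltyForm (σ : ℝ) (hF : M.facets → ℝ) :
    BrokenField M →ₗ[ℝ] BrokenField M →ₗ[ℝ] ℝ :=
  ∑ F : M.facets, integralBilin (facetMeasure M F)
    (fun x => (σ / hF F) • innerComp (vjumpLin M F x) (vjumpLin M F x))
    fun v w => M.integrable_facet F
      (continuous_const.mul ((continuous_vjump M v F).inner (continuous_vjump M w F)))

theorem penaltyForm_apply (σ : ℝ) (hF : M.facets → ℝ) (w v : BrokenField M) :
    penaltyForm M σ hF w v
      = ∑ F, ∫ x, σ / hF F * ⟪vjump M w F x, vjump M v F x⟫ ∂(facetMeasure M F) := by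
  simp only [penaltyForm, LinearMap.sum_apply, integralBilin_apply, innerComp_apply,
    LinearMap.smul_apply, smul_eq_mul]
  rfl

/-- The interior penalty form as a bilinear map. -/
noncomputable def aBilin (σ : ℝ) (hF : M.facets → ℝ) :
    BrokenField M →ₗ[ℝ] BrokenField M →ₗ[ℝ] ℝ :=
  gradForm M - consForm M - (consForm M).flip + penaltyForm M σ hF

theorem aBilin_apply (σ : ℝ) (hF : M.facets → ℝ) (w v : BrokenField M) :
    aBilin M σ hF w v = aForm M σ hF w v := by
  simp only [aBilin, LinearMap.add_apply, LinearMap.sub_apply, LinearMap.flip_apply,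
    gradForm_apply, consForm_apply, penaltyForm_apply, aForm, real_inner_comm]

theorem energySq_eq (σ : ℝ) (hF : M.facets → ℝ) (w : BrokenField M) :
    energySq M σ hF w = gradForm M w w + penaltyForm M σ hF w w := by
  simp only [energySq, gradForm_apply, penaltyForm_apply, sq, integral_const_mul,
    real_inner_self_eq_norm_mul_norm]

/-- The pressure-velocity coupling as a bilinear map. -/
noncomputable def bBilin : BrokenField M →ₗ[ℝ] BrokenScalar M →ₗ[ℝ] ℝ :=
  -∑ K : M.elems, integralBilin (volume.restrict K.1)
    (fun x => LinearMap.mk₂ ℝ (fun w q => peval (q K) x * divg (w K) x)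
      (fun w w' q => by simp [divg_add, mul_add])
      (fun c w q => by simp [divg_smul, mul_left_comm])
      (fun w q q' => by simp [peval_add, add_mul])
      (fun c w q => by simp [peval_smul, mul_assoc]))
    fun w q => M.integrable_elem K ((continuous_peval (q K)).mul (continuous_divg (w K)))

theorem bBilin_apply (w : BrokenField M) (q : BrokenScalar M) : bBilin M w q = bForm M w q := by
  simp only [bBilin, LinearMap.neg_apply, LinearMap.sum_apply]
  rfl

end Forms

section Convection

variable {d : ℕ} (M : Mesh d)

/-- A convective velocity at a fixed time: bounded, with bounded normal traces. -/
def IsBoundedVelocity (b : Vec d → Vec d) (bn : M.facets → Vec d → ℝ) : Prop :=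
  MemLp b ∞ (volume.restrict M.Ω) ∧ ∀ F, MemLp (bn F) ∞ (facetMeasure M F)

variable {M}

theorem ae_norm_le_of_memLp_top {X E : Type*} [MeasurableSpace X] [NormedAddCommGroup E]
    {μ : Measure X} {f : X → E} (hf : MemLp f ∞ μ) : ∃ B : ℝ, 0 ≤ B ∧ ∀ᵐ x ∂μ, ‖f x‖ ≤ B := by
  have h1 : eLpNormEssSup f μ ≠ ⊤ := by
    have := hf.eLpNorm_ne_top
    rwa [eLpNorm_exponent_top] at this
  refine ⟨(eLpNormEssSup f μ).toReal, ENNReal.toReal_nonneg, ?_⟩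
  filter_upwards [enorm_ae_le_eLpNormEssSup f μ] with x hx
  rw [← toReal_enorm]
  exact ENNReal.toReal_mono h1 hx

theorem exists_bound_dirDeriv_inner (K : M.elems) (w v : BrokenField M) (B : ℝ) :
    ∃ C : ℝ, ∀ b, ‖b‖ ≤ B → ∀ x ∈ K.1, ‖⟪dirDeriv (w K) b x, val (v K) x⟫‖ ≤ C := by
  have hcont : Continuous fun q : Vec d × Vec d => ⟪dirDeriv (w K) q.1 q.2, val (v K) q.2⟫ :=
    (continuous_dirDeriv_uncurry (w K)).inner ((continuous_val (v K)).comp continuous_snd)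
  obtain ⟨C, hC⟩ := ((isCompact_closedBall (0 : Vec d) B).prod
    (M.isCompact K)).exists_bound_of_continuousOn hcont.continuousOn
  exact ⟨C, fun b hb x hx => hC (b, x) ⟨by simpa using hb, hx⟩⟩

theorem integrable_convection {b : Vec d → Vec d} (hb : MemLp b ∞ (volume.restrict M.Ω))
    (K : M.elems) (w v : BrokenField M) :
    IntegrableOn (fun x => ⟪dirDeriv (w K) (b x) x, val (v K) x⟫) K.1 := by
  have hbK := hb.mono_measure (M.restrict_le K)
  obtain ⟨B, -, hB⟩ := ae_norm_le_of_memLp_top hbK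
  obtain ⟨C, hC⟩ := exists_bound_dirDeriv_inner K w v B
  refine Integrable.of_bound ?_ C ?_
  · have h1 : AEStronglyMeasurable (fun x => (b x, x)) (volume.restrict K.1) :=
      hbK.aestronglyMeasurable.prodMk aestronglyMeasurable_id
    exact ((continuous_dirDeriv_uncurry (w K)).comp_aestronglyMeasurable h1).inner
      (continuous_val (v K)).aestronglyMeasurable
  · filter_upwards [hB, self_mem_ae_restrict (M.isCompact K).measurableSet] with x hx hxK
    exact hC _ hx x hxK

theorem integrable_facet_mul {F : M.facets} {η g : Vec d → ℝ}
    (hη : MemLp η ∞ (facetMeasure M F)) (hg : Continuous g) :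
    Integrable (fun x => η x * g x) (facetMeasure M F) := by
  obtain ⟨B, -, hB⟩ := ae_norm_le_of_memLp_top hη
  exact (M.integrable_facet F hg).bdd_mul hη.aestronglyMeasurable hB

open Classical in
/-- The upwind form `∑_F ∫_F (γ/2) |b · n_F| [[w]] · [[v]]`. -/
noncomputable def upwForm (γ : ℝ) {b : Vec d → Vec d} {bn : M.facets → Vec d → ℝ}
    (h : IsBoundedVelocity M b bn) : BrokenField M →ₗ[ℝ] BrokenField M →ₗ[ℝ] ℝ :=
  ∑ F with M.IsInterior F, integralBilin (facetMeasure M F)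
    (fun x => (γ / 2 * |bn F x|) • innerComp (vjumpLin M F x) (vjumpLin M F x))
    fun v w => by
      have hη : MemLp (fun x => γ / 2 * |bn F x|) ∞ (facetMeasure M F) :=
        (h.2 F).norm.const_mul _
      exact integrable_facet_mul hη ((continuous_vjump M v F).inner (continuous_vjump M w F))

open Classical in
theorem upwForm_apply (γ : ℝ) {b : Vec d → Vec d} {bn : M.facets → Vec d → ℝ}
    (h : IsBoundedVelocity M b bn) (w v : BrokenField M) :
    upwForm γ h w v = ∑ F with M.IsInterior F, ∫ x, γ / 2 * |bn F x| *
        ⟪vjump M w F x, vjump M v F x⟫ ∂(facetMeasure M F) := by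
  simp only [upwForm, LinearMap.sum_apply, integralBilin_apply, innerComp_apply,
    LinearMap.smul_apply, smul_eq_mul]
  rfl

open Classical in
/-- The convection form as a bilinear map, for a bounded convective velocity. -/
noncomputable def cBilin (γ : ℝ) {b : Vec d → Vec d} {bn : M.facets → Vec d → ℝ}
    (h : IsBoundedVelocity M b bn) : BrokenField M →ₗ[ℝ] BrokenField M →ₗ[ℝ] ℝ :=
  (∑ K : M.elems, integralBilin (volume.restrict K.1)
      (fun x => innerComp (dirDerivLin M K (b x) x) (valLin M K x))
      fun w v => integrable_convection h.1 K w v)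
    - (∑ F with M.IsInterior F, integralBilin (facetMeasure M F)
      (fun x => bn F x • innerComp (vjumpLin M F x) (vavgLin M F x))
      fun v w => integrable_facet_mul (h.2 F)
        ((continuous_vjump M v F).inner (continuous_vavg M w F)))
    + upwForm γ h

theorem cBilin_apply (γ : ℝ) {b : Vec d → Vec d} {bn : M.facets → Vec d → ℝ}
    (h : IsBoundedVelocity M b bn) (w v : BrokenField M) :
    cBilin γ h w v = cForm M γ b bn w v := by
  simp only [cBilin, LinearMap.add_apply, LinearMap.sub_apply, LinearMap.sum_apply,
    integralBilin_apply, innerComp_apply, upwForm_apply, LinearMap.smul_apply, smul_eq_mul]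
  rfl

theorem upwSq_eq (γ : ℝ) {b : Vec d → Vec d} {bn : M.facets → Vec d → ℝ}
    (h : IsBoundedVelocity M b bn) (w : BrokenField M) :
    upwSq M γ bn w = upwForm γ h w w := by
  simp only [upwSq, upwForm_apply, real_inner_self_eq_norm_sq]

/-- Skew-symmetry of the convection form up to upwinding: Green's formula with the test function
`|v|² / 2` on each element turns the volume term into the facet terms, and
`[[v]] · {{v}} = [[|v|²]] / 2`. -/
theorem cForm_self (γ : ℝ) {b : Vec d → Vec d} {bn : M.facets → Vec d → ℝ}
    (h : IsBoundedVelocity M b bn) (hn : IsNormalTrace M b bn)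
    (h0 : ∀ F, ¬ M.IsInterior F → ∀ᵐ x ∂(facetMeasure M F), bn F x = 0) (v : BrokenField M) :
    cForm M γ b bn v v = upwSq M γ bn v := by
  classical
  have hK : ∀ K : M.elems, ∫ x in K.1, ⟪dirDeriv (v K) (b x) x, val (v K) x⟫
      = ∑ F : M.facets, if K = M.pos F then ∫ x, bn F x * peval (halfSq (v K)) x ∂(facetMeasure M F)
        else if K = M.neg F then -∫ x, bn F x * peval (halfSq (v K)) x ∂(facetMeasure M F)
        else 0 := fun K => by
    have := hn K (peval (halfSq (v K))) (contDiff_peval _)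
    simp only [inner_gradient_halfSq] at this
    rw [this]
  have hvol : ∑ K : M.elems, ∫ x in K.1, ⟪dirDeriv (v K) (b x) x, val (v K) x⟫
      = ∑ F with M.IsInterior F, ∫ x, bn F x *
        ⟪vjump M v F x, avg M (fun K => val (v K)) F x⟫ ∂(facetMeasure M F) := by
    rw [Finset.sum_congr rfl fun K _ => hK K, Finset.sum_comm, Finset.sum_filter]
    refine Finset.sum_congr rfl fun F _ => ?_
    by_cases hF : M.IsInterior F
    · have hne : M.pos F ≠ M.neg F := hF
      rw [if_pos hF]
      have hsplit : ∀ K : M.elems, (if K = M.pos F then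
          ∫ x, bn F x * peval (halfSq (v K)) x ∂(facetMeasure M F)
          else if K = M.neg F then -∫ x, bn F x * peval (halfSq (v K)) x ∂(facetMeasure M F)
          else 0) = (if K = M.pos F then
          ∫ x, bn F x * peval (halfSq (v K)) x ∂(facetMeasure M F) else 0)
          + if K = M.neg F then -∫ x, bn F x * peval (halfSq (v K)) x ∂(facetMeasure M F)
          else 0 := by
        intro K
        by_cases h1 : K = M.pos F
        · have h2 : K ≠ M.neg F := h1 ▸ hne
          simp [h1, hne]
        · simp [h1]
      rw [Finset.sum_congr rfl fun K _ => hsplit K, Finset.sum_add_distrib, Finset.sum_ite_eq',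
        Finset.sum_ite_eq', if_pos (Finset.mem_univ _), if_pos (Finset.mem_univ _),
        ← sub_eq_add_neg, ← integral_sub (integrable_facet_mul (h.2 F) (continuous_peval _))
          (integrable_facet_mul (h.2 F) (continuous_peval _))]
      congr 1
      funext x
      rw [← mul_sub, peval_halfSq, peval_halfSq, vjump, jump, avg, if_pos hF, if_pos hF,
        real_inner_smul_right, inner_add_right, inner_sub_left, inner_sub_left,
        real_inner_self_eq_norm_sq, real_inner_self_eq_norm_sq,
        real_inner_comm (val (v (M.pos F)) x)]
      ring
    · have heq : M.pos F = M.neg F := not_not.1 hF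
      rw [if_neg hF, Finset.sum_eq_single (M.pos F), if_pos rfl]
      · refine integral_eq_zero_of_ae ?_
        filter_upwards [h0 F hF] with x hx
        simp [hx]
      · intro K _ hne
        rw [if_neg hne, if_neg (heq ▸ hne)]
      · intro hcon; exact absurd (Finset.mem_univ _) hcon
  have e1 : cForm M γ b bn v v = (∑ K : M.elems, ∫ x in K.1, ⟪dirDeriv (v K) (b x) x, val (v K) x⟫)
      - (∑ F with M.IsInterior F, ∫ x, bn F x *
        ⟪vjump M v F x, avg M (fun K => val (v K)) F x⟫ ∂(facetMeasure M F))
      + ∑ F with M.IsInterior F, ∫ x, γ / 2 * |bn F x| *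
        ⟪vjump M v F x, vjump M v F x⟫ ∂(facetMeasure M F) := by
    unfold cForm; congr
  rw [e1, hvol, sub_self, zero_add, upwSq]
  simp only [real_inner_self_eq_norm_sq]

end Convection

/-! ### Coercivity of the interior penalty form, and measurability in time of the forms -/

section Coercivity

variable {d : ℕ}

theorem totalDegree_pderiv_le (p : MvPolynomial (Fin d) ℝ) (j : Fin d) :
    (MvPolynomial.pderiv j p).totalDegree ≤ p.totalDegree := by
  conv_lhs => rw [p.as_sum, map_sum]
  refine MvPolynomial.totalDegree_finsetSum_le fun s hs => ?_
  rw [MvPolynomial.pderiv_monomial]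
  refine (MvPolynomial.totalDegree_monomial_le _ _).trans ?_
  exact (Finsupp.degree_mono tsub_le_self).trans (MvPolynomial.le_totalDegree hs)

theorem totalDegree_sum_smul_le {m : ℕ} (c : Fin d → ℝ) (p : Fin d → MvPolynomial (Fin d) ℝ)
    (hp : ∀ j, (p j).totalDegree ≤ m) : (∑ j, c j • p j).totalDegree ≤ m := by
  rw [← MvPolynomial.mem_restrictTotalDegree]
  exact Submodule.sum_mem _ fun j _ => Submodule.smul_mem _ _
    ((MvPolynomial.mem_restrictTotalDegree _ _ _).2 (hp j))

theorem dirDeriv_apply (v : PolyField d) (n x : Vec d) (i : Fin d) :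
    dirDeriv v n x i = ∑ j, jac v x i j * n j := rfl

/-- The normal derivative on a facet is controlled by the gradient on the element. -/
theorem integral_dirDeriv_sq_le {m : ℕ} {C ρ : ℝ} (hC : 0 ≤ C / ρ) {K F : Set (Vec d)}
    (hKc : IsCompact K)
    (hFfin : IsFiniteMeasure ((Measure.euclideanHausdorffMeasure (d - 1)).restrict F))
    (hFc : IsCompact F)
    (htr : ∀ p : MvPolynomial (Fin d) ℝ, p.totalDegree ≤ m →
      ∫ x in F, peval p x ^ 2 ∂(Measure.euclideanHausdorffMeasure (d - 1))
        ≤ C / ρ * ∫ x in K, peval p x ^ 2)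
    {v : PolyField d} (hv : ∀ i, (v i).totalDegree ≤ m) {n : Vec d} (hn : ‖n‖ = 1) :
    ∫ x in F, ‖dirDeriv v n x‖ ^ 2 ∂(Measure.euclideanHausdorffMeasure (d - 1))
      ≤ C / ρ * ∫ x in K, ∑ i, ∑ j, jac v x i j ^ 2 := by
  let p : Fin d → MvPolynomial (Fin d) ℝ := fun i => ∑ j, n j • MvPolynomial.pderiv j (v i)
  have hpd : ∀ i, (p i).totalDegree ≤ m := fun i =>
    totalDegree_sum_smul_le _ _ fun j => (totalDegree_pderiv_le _ _).trans (hv i)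
  have hpe : ∀ i x, peval (p i) x = ∑ j, jac v x i j * n j := by
    intro i x
    simp [p, peval, jac, mul_comm]
  have hdir : ∀ x, ‖dirDeriv v n x‖ ^ 2 = ∑ i, peval (p i) x ^ 2 := by
    intro x
    rw [EuclideanSpace.norm_sq_eq]
    simp only [dirDeriv_apply, hpe, Real.norm_eq_abs, sq_abs]
  have hn2 : ∑ j, n j ^ 2 = 1 := by
    have := EuclideanSpace.norm_sq_eq n
    rw [hn] at this
    simpa using this.symm
  have hpc : ∀ i, Continuous fun x => peval (p i) x ^ 2 := fun i => (continuous_peval (p i)).pow 2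
  simp only [hdir]
  rw [integral_finsetSum _ fun i _ => integrableOn_of_continuous hFc (hpc i)]
  calc _ ≤ ∑ i, C / ρ * ∫ x in K, peval (p i) x ^ 2 :=
        Finset.sum_le_sum fun i _ => htr (p i) (hpd i)
    _ = C / ρ * ∫ x in K, ∑ i, peval (p i) x ^ 2 := by
        rw [← Finset.mul_sum, integral_finsetSum _ fun i _ =>
          (hpc i).continuousOn.integrableOn_compact hKc]
    _ ≤ _ := by
        refine mul_le_mul_of_nonneg_left (integral_mono ?_ ?_ fun x => ?_) hC
        · exact (continuous_finsetSum _ fun i _ => hpc i).continuousOn.integrableOn_compact hKc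
        · exact (continuous_finsetSum _ fun i _ => continuous_finsetSum _ fun j _ =>
            (continuous_jac v i j).pow 2).continuousOn.integrableOn_compact hKc
        · refine Finset.sum_le_sum fun i _ => ?_
          rw [hpe]
          have := Finset.sum_mul_sq_le_sq_mul_sq Finset.univ (fun j => jac v x i j) fun j => n j
          rwa [hn2, mul_one] at this

variable (M : Mesh d)

open Classical in
/-- The averaged normal derivative is bounded by the normal derivatives from all elements that have
the facet in common. -/
theorem norm_gradNormalAvg_sq_le (v : BrokenField M) (F : M.facets) (x : Vec d) :
    ‖gradNormalAvg M v F x‖ ^ 2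
      ≤ ∑ K with IsFacet K.1 F.1, ‖dirDeriv (v K) (M.normal F) x‖ ^ 2 := by
  have hp : M.pos F ∈ Finset.univ.filter fun K : M.elems => IsFacet K.1 F.1 := by
    simp [M.pos_facet F]
  have hq : M.neg F ∈ Finset.univ.filter fun K : M.elems => IsFacet K.1 F.1 := by
    simp [M.neg_facet F]
  rw [gradNormalAvg, avg]
  split_ifs with h
  · set a := dirDeriv (v (M.pos F)) (M.normal F) x
    set b := dirDeriv (v (M.neg F)) (M.normal F) x
    have h1 : ‖(1 / 2 : ℝ) • (a + b)‖ ^ 2 ≤ ‖a‖ ^ 2 + ‖b‖ ^ 2 := by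
      rw [norm_smul, Real.norm_of_nonneg (by norm_num)]
      have h2 := norm_add_le a b
      have h3 : ‖a + b‖ ^ 2 ≤ (‖a‖ + ‖b‖) ^ 2 := by gcongr
      nlinarith [sq_nonneg (‖a‖ - ‖b‖)]
    refine h1.trans ?_
    have hne : M.pos F ≠ M.neg F := h
    rw [← Finset.sum_pair (f := fun K => ‖dirDeriv (v K) (M.normal F) x‖ ^ 2) hne]
    refine Finset.sum_le_sum_of_subset_of_nonneg ?_ fun K _ _ => sq_nonneg _
    intro K hK
    rcases Finset.mem_insert.1 hK with rfl | hK
    · exact hp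
    · rw [Finset.mem_singleton.1 hK]; exact hq
  · exact Finset.single_le_sum (f := fun K => ‖dirDeriv (v K) (M.normal F) x‖ ^ 2)
      (fun K _ => sq_nonneg _) hp

variable {M}

theorem ShapeRegular.facet_pos (hd : 0 < d) {κ : ℝ} (hκ : 0 < κ) {N : ℕ} {hF : M.facets → ℝ}
    (h : ShapeRegular M κ N hF) (F : M.facets) : 0 < hF F :=
  (div_pos (M.diam_pos hd (M.pos F)) hκ).trans_le (h.2.2 F (M.pos F) (M.pos_facet F)).1

/-- The averaged normal derivatives on the skeleton, weighted by the facet lengths, are controlled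
by the elementwise gradient. -/
theorem exists_sum_gradNormalAvg_le (hd : 0 < d) (m N : ℕ) {κ : ℝ} (hκ : 0 < κ) :
    ∃ Λ : ℝ, 0 < Λ ∧ ∀ (M : Mesh d) (hF : M.facets → ℝ), ShapeRegular M κ N hF →
      ∀ v : BrokenField M, (∀ K i, (v K i).totalDegree ≤ m) →
      ∑ F, hF F * ∫ x, ‖gradNormalAvg M v F x‖ ^ 2 ∂(facetMeasure M F) ≤ Λ * gradForm M v v := by
  classical
  obtain ⟨C, hC, htr⟩ := exists_trace_constant d m
  -- The summand `1` only keeps the constant positive when `N = 0`.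
  refine ⟨C * κ ^ 2 * (N + 1), by positivity, fun M hF hreg v hv => ?_⟩
  let G : M.elems → ℝ := fun K => ∫ x in K.1, ∑ i, ∑ j, jac (v K) x i j ^ 2
  have hG0 : ∀ K, 0 ≤ G K := fun K => integral_nonneg fun x =>
    Finset.sum_nonneg fun i _ => Finset.sum_nonneg fun j _ => sq_nonneg _
  have hgrad : gradForm M v v = ∑ K, G K := by
    simp only [gradForm_apply, G, sq]
  have hKF : ∀ (F : M.facets) (K : M.elems), IsFacet K.1 F.1 →
      hF F * ∫ x, ‖dirDeriv (v K) (M.normal F) x‖ ^ 2 ∂(facetMeasure M F) ≤ C * κ ^ 2 * G K := by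
    intro F K hFK
    obtain ⟨x₀, hx₀⟩ := hreg.1 K.1 K.2
    have hdiam := M.diam_pos hd K
    have hρ : 0 < Metric.diam K.1 / κ := by positivity
    have h1 : ∫ x, ‖dirDeriv (v K) (M.normal F) x‖ ^ 2 ∂(facetMeasure M F)
        ≤ C / (Metric.diam K.1 / κ) * G K :=
      integral_dirDeriv_sq_le (by positivity) (M.isCompact K)
        (inferInstanceAs (IsFiniteMeasure (facetMeasure M F))) (M.facet_isCompact F)
        (htr K.1 F.1 (M.convex K) (M.isCompact K) (M.interior_nonempty K.1 K.2) hFK x₀ _ hρ hx₀)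
        (hv K) (M.norm_normal F)
    have h2 := (hreg.2.2 F K hFK).2
    have h3 := hreg.facet_pos hd hκ F
    have h4 := hG0 K
    calc _ ≤ hF F * (C / (Metric.diam K.1 / κ) * G K) := by gcongr
      _ ≤ κ * Metric.diam K.1 * (C / (Metric.diam K.1 / κ) * G K) := by gcongr
      _ = C * κ ^ 2 * G K := by field_simp
  have hFsum : ∀ F : M.facets, hF F * ∫ x, ‖gradNormalAvg M v F x‖ ^ 2 ∂(facetMeasure M F)
      ≤ ∑ K with IsFacet K.1 F.1, C * κ ^ 2 * G K := by
    intro F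
    have h3 := hreg.facet_pos hd hκ F
    have hc : ∀ K : M.elems, Continuous fun x => ‖dirDeriv (v K) (M.normal F) x‖ ^ 2 :=
      fun K => (continuous_dirDeriv (v K) _).norm.pow 2
    have h5 : ∫ x, ‖gradNormalAvg M v F x‖ ^ 2 ∂(facetMeasure M F)
        ≤ ∑ K with IsFacet K.1 F.1,
          ∫ x, ‖dirDeriv (v K) (M.normal F) x‖ ^ 2 ∂(facetMeasure M F) := by
      rw [← integral_finsetSum _ fun K _ => M.integrable_facet F (hc K)]
      exact integral_mono (M.integrable_facet F ((continuous_gradNormalAvg M v F).norm.pow 2))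
        (M.integrable_facet F (continuous_finsetSum _ fun K _ => hc K))
        fun x => norm_gradNormalAvg_sq_le M v F x
    calc _ ≤ hF F * _ := mul_le_mul_of_nonneg_left h5 h3.le
      _ = _ := Finset.mul_sum _ _ _
      _ ≤ _ := Finset.sum_le_sum fun K hK => hKF F K (Finset.mem_filter.1 hK).2
  have hcard : ∀ K : M.elems,
      (((Finset.univ.filter fun F : M.facets => IsFacet K.1 F.1).card : ℕ) : ℝ) ≤ N + 1 := by
    intro K
    have h1 := hreg.2.1 K.1 K.2
    have h2 : (Finset.univ.filter fun F : M.facets => IsFacet K.1 F.1).card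
        = {F : Set (Vec d) | F ∈ M.facets ∧ IsFacet K.1 F}.ncard := by
      rw [← Finset.card_map (Function.Embedding.subtype _), ← Set.ncard_coe_finset]
      congr 1
      ext F
      simp [and_comm]
    rw [h2]
    exact_mod_cast h1.trans (Nat.le_succ N)
  calc _ ≤ ∑ F : M.facets, ∑ K with IsFacet K.1 F.1, C * κ ^ 2 * G K :=
        Finset.sum_le_sum fun F _ => hFsum F
    _ = ∑ K : M.elems, ∑ F : M.facets with IsFacet K.1 F.1, C * κ ^ 2 * G K := by
        simp only [Finset.sum_filter]
        exact Finset.sum_comm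
    _ ≤ ∑ K : M.elems, (N + 1) * (C * κ ^ 2 * G K) := by
        refine Finset.sum_le_sum fun K _ => ?_
        rw [Finset.sum_const, nsmul_eq_mul]
        have := hG0 K
        gcongr
        exact hcard K
    _ = _ := by
        rw [hgrad, ← Finset.mul_sum, ← Finset.mul_sum]
        ring

/-- Coercivity of the interior penalty form on broken polynomials of bounded degree. -/
theorem exists_aForm_coercive (hd : 0 < d) (m N : ℕ) {κ : ℝ} (hκ : 0 < κ) :
    ∃ σ₀ : ℝ, 0 < σ₀ ∧ ∀ σ : ℝ, σ₀ ≤ σ → ∀ (M : Mesh d) (hF : M.facets → ℝ),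
      ShapeRegular M κ N hF → ∀ v : BrokenField M, (∀ K i, (v K i).totalDegree ≤ m) →
      1 / 2 * energySq M σ hF v ≤ aForm M σ hF v v := by
  obtain ⟨Λ, hΛ, hsum⟩ := exists_sum_gradNormalAvg_le hd m N hκ
  refine ⟨4 * Λ, by positivity, fun σ hσ M hF hreg v hv => ?_⟩
  have hS := hsum M hF hreg v hv
  let J : M.facets → ℝ := fun F => ∫ x, ‖vjump M v F x‖ ^ 2 ∂(facetMeasure M F)
  let D : M.facets → ℝ := fun F => ∫ x, ‖gradNormalAvg M v F x‖ ^ 2 ∂(facetMeasure M F)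
  have hJ0 : ∀ F, 0 ≤ J F := fun F => integral_nonneg fun x => sq_nonneg _
  have hpen : penaltyForm M σ hF v v = ∑ F, σ / hF F * J F := by
    simp only [penaltyForm_apply, J, integral_const_mul, real_inner_self_eq_norm_sq]
  -- Young's inequality with the weight that absorbs half of the gradient term.
  have hcons : ∀ F, 2 * ∫ x, ⟪gradNormalAvg M v F x, vjump M v F x⟫ ∂(facetMeasure M F)
      ≤ hF F / (2 * Λ) * D F + 2 * Λ / hF F * J F := by
    intro F
    have h3 := hreg.facet_pos hd hκ F
    have hcg := continuous_gradNormalAvg M v F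
    have hcj := continuous_vjump M v F
    have hcg2 : Continuous fun x => hF F / (2 * Λ) * ‖gradNormalAvg M v F x‖ ^ 2 :=
      continuous_const.mul (hcg.norm.pow 2)
    have hcj2 : Continuous fun x => 2 * Λ / hF F * ‖vjump M v F x‖ ^ 2 :=
      continuous_const.mul (hcj.norm.pow 2)
    rw [← integral_const_mul, ← integral_const_mul, ← integral_const_mul, ← integral_add
      (M.integrable_facet F hcg2) (M.integrable_facet F hcj2)]
    refine integral_mono (M.integrable_facet F (continuous_const.mul (hcg.inner hcj)))
      (M.integrable_facet F (hcg2.add hcj2)) fun x => ?_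
    have h4 := real_inner_le_norm (gradNormalAvg M v F x) (vjump M v F x)
    set a := ‖gradNormalAvg M v F x‖
    set b := ‖vjump M v F x‖
    have h5 : hF F / (2 * Λ) * a ^ 2 + 2 * Λ / hF F * b ^ 2 - 2 * (a * b)
        = hF F / (2 * Λ) * (a - 2 * Λ / hF F * b) ^ 2 := by
      field_simp
      ring
    have h6 : 0 ≤ hF F / (2 * Λ) * (a - 2 * Λ / hF F * b) ^ 2 := by positivity
    simp only
    linarith
  have hcons' : 2 * consForm M v v ≤ 1 / 2 * gradForm M v v + ∑ F, 2 * Λ / hF F * J F := by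
    rw [consForm_apply, Finset.mul_sum]
    refine (Finset.sum_le_sum fun F _ => hcons F).trans ?_
    rw [Finset.sum_add_distrib]
    have h7 : ∑ F, hF F / (2 * Λ) * D F = 1 / (2 * Λ) * ∑ F, hF F * D F := by
      rw [Finset.mul_sum]
      exact Finset.sum_congr rfl fun F _ => by ring
    have h8 : 1 / (2 * Λ) * ∑ F, hF F * D F ≤ 1 / 2 * gradForm M v v := by
      calc _ ≤ 1 / (2 * Λ) * (Λ * gradForm M v v) := by gcongr
        _ = _ := by field_simp
    linarith
  have hpen' : ∑ F, 2 * Λ / hF F * J F ≤ 1 / 2 * penaltyForm M σ hF v v := by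
    rw [hpen, Finset.mul_sum]
    refine Finset.sum_le_sum fun F _ => ?_
    have h3 := hreg.facet_pos hd hκ F
    have h9 : 2 * Λ / hF F ≤ 1 / 2 * (σ / hF F) := by
      have h10 : 1 / 2 * (σ / hF F) = σ / 2 / hF F := by ring
      rw [h10]
      gcongr
      linarith
    rw [← mul_assoc]
    exact mul_le_mul_of_nonneg_right h9 (hJ0 F)
  rw [energySq_eq, ← aBilin_apply]
  simp only [aBilin, LinearMap.add_apply, LinearMap.sub_apply, LinearMap.flip_apply]
  linarith

end Coercivity

section Time

variable {d : ℕ} {M : Mesh d}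

theorem memLp_top_integral {X Y : Type*} [MeasurableSpace X] [MeasurableSpace Y] {μ : Measure X}
    {ν : Measure Y} [SFinite μ] [IsFiniteMeasure ν] {f : X → Y → ℝ}
    (hf : MemLp (fun z : X × Y => f z.1 z.2) ∞ (μ.prod ν)) :
    MemLp (fun x => ∫ y, f x y ∂ν) ∞ μ := by
  obtain ⟨B, hB, hb⟩ := ae_norm_le_of_memLp_top hf
  refine memLp_top_of_bound hf.aestronglyMeasurable.integral_prod_right' (B * ν.real univ) ?_
  filter_upwards [Measure.ae_ae_of_ae_prod hb] with x hx
  exact norm_integral_le_of_norm_le_const hx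

/-- Almost every section of an essentially bounded function is essentially bounded. -/
theorem memLp_top_section {X Y E : Type*} [MeasurableSpace X] [MeasurableSpace Y]
    [NormedAddCommGroup E] {μ : Measure X}
    {ν : Measure Y} [SFinite μ] [SFinite ν] {f : X → Y → E}
    (hf : MemLp (fun z : X × Y => f z.1 z.2) ∞ (μ.prod ν)) : ∀ᵐ x ∂μ, MemLp (f x) ∞ ν := by
  obtain ⟨B, hB, hb⟩ := ae_norm_le_of_memLp_top hf
  filter_upwards [Measure.ae_ae_of_ae_prod hb, hf.aestronglyMeasurable.prodMk_left] with x hx hx'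
  exact memLp_top_of_bound hx' B hx

theorem memLp_top_facet_mul {T : ℝ} {F : M.facets} {η : ℝ → Vec d → ℝ}
    (hη : MemLp (fun z : ℝ × Vec d => η z.1 z.2) ∞
      ((volume.restrict (Ioc 0 T)).prod (facetMeasure M F))) {g : Vec d → ℝ} (hg : Continuous g) :
    MemLp (fun t => ∫ x, η t x * g x ∂(facetMeasure M F)) ∞ (volume.restrict (Ioc 0 T)) := by
  obtain ⟨B, hB, hb⟩ := ae_norm_le_of_memLp_top hη
  obtain ⟨C, hC⟩ := (M.facet_isCompact F).exists_bound_of_continuousOn hg.continuousOn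
  have hC' : ∀ᵐ x ∂(facetMeasure M F), ‖g x‖ ≤ C := by
    filter_upwards [self_mem_ae_restrict (M.facet_isCompact F).measurableSet] with x hx
    exact hC x hx
  refine memLp_top_integral (f := fun t x => η t x * g x) ?_
  refine memLp_top_of_bound
    (hη.aestronglyMeasurable.mul (hg.comp continuous_snd).aestronglyMeasurable) (B * C) ?_
  filter_upwards [hb, Measure.quasiMeasurePreserving_snd.ae hC'] with z h1 h2
  rw [norm_mul]
  exact mul_le_mul h1 h2 (norm_nonneg _) hB

theorem memLp_top_convection {T : ℝ} {β : ℝ → Vec d → Vec d}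
    (hβ : MemLp (fun z : ℝ × Vec d => β z.1 z.2) ∞
      ((volume.restrict (Ioc 0 T)).prod (volume.restrict M.Ω))) (K : M.elems)
    (w v : BrokenField M) :
    MemLp (fun t => ∫ x in K.1, ⟪dirDeriv (w K) (β t x) x, val (v K) x⟫) ∞
      (volume.restrict (Ioc 0 T)) := by
  have hβK : MemLp (fun z : ℝ × Vec d => β z.1 z.2) ∞
      ((volume.restrict (Ioc 0 T)).prod (volume.restrict K.1)) :=
    hβ.mono_measure (Measure.prod_mono le_rfl (M.restrict_le K))
  obtain ⟨B, -, hB⟩ := ae_norm_le_of_memLp_top hβK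
  obtain ⟨C, hC⟩ := exists_bound_dirDeriv_inner K w v B
  have hK : ∀ᵐ x ∂(volume.restrict K.1), x ∈ K.1 :=
    self_mem_ae_restrict (M.isCompact K).measurableSet
  refine memLp_top_integral (f := fun t x => ⟪dirDeriv (w K) (β t x) x, val (v K) x⟫) ?_
  refine memLp_top_of_bound ?_ C ?_
  · have h1 : AEStronglyMeasurable (fun z : ℝ × Vec d => (β z.1 z.2, z.2))
        ((volume.restrict (Ioc 0 T)).prod (volume.restrict K.1)) :=
      hβK.aestronglyMeasurable.prodMk continuous_snd.aestronglyMeasurable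
    exact ((continuous_dirDeriv_uncurry (w K)).comp_aestronglyMeasurable h1).inner
      ((continuous_val (v K)).comp continuous_snd).aestronglyMeasurable
  · filter_upwards [hB, Measure.quasiMeasurePreserving_snd.ae hK] with z h1 h2
    exact hC _ h1 _ h2

variable {T : ℝ} {β : ℝ → Vec d → Vec d} {βn : ℝ → M.facets → Vec d → ℝ}

theorem IsConvectiveField.ae_isBoundedVelocity (h : IsConvectiveField M T β βn) :
    ∀ᵐ t ∂(volume.restrict (Ioc 0 T)), IsBoundedVelocity M (β t) (βn t) := by
  filter_upwards [memLp_top_section h.1,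
    ae_all_iff.2 fun F => memLp_top_section (f := fun t x => βn t F x) (h.2.1 F)] with t h1 h2
  exact ⟨h1, h2⟩

open Classical in
theorem IsConvectiveField.memLp_upw (h : IsConvectiveField M T β βn) (γ : ℝ)
    (w v : BrokenField M) :
    MemLp (fun t => ∑ F with M.IsInterior F, ∫ x, γ / 2 * |βn t F x| *
        ⟪vjump M w F x, vjump M v F x⟫ ∂(facetMeasure M F)) ∞ (volume.restrict (Ioc 0 T)) :=
  memLp_finsetSum _ fun F _ => memLp_top_facet_mul (η := fun t x => γ / 2 * |βn t F x|)
    ((h.2.1 F).norm.const_mul (γ / 2)) ((continuous_vjump M w F).inner (continuous_vjump M v F))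

theorem IsConvectiveField.memLp_cForm (h : IsConvectiveField M T β βn) (γ : ℝ)
    (w v : BrokenField M) :
    MemLp (fun t => cForm M γ (β t) (βn t) w v) ∞ (volume.restrict (Ioc 0 T)) := by
  refine ((memLp_finsetSum _ fun K _ => memLp_top_convection h.1 K w v).sub
    (memLp_finsetSum _ fun F _ => memLp_top_facet_mul (h.2.1 F)
      ((continuous_vjump M w F).inner (continuous_vavg M v F)))).add (h.memLp_upw γ w v)

end Time

/-! ### Energy estimate, existence and uniqueness -/

/-- The energy estimate for an absolutely continuous curve whose energy is dissipated at rate `D`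
and fed at rate at most `φ ‖x‖`. -/
theorem energy_estimate {H : Type*} [NormedAddCommGroup H] [InnerProductSpace ℝ H]
    [CompleteSpace H] {x g : ℝ → H} {φ D : ℝ → ℝ} {T : ℝ} (hg : IntegrableOn g (Ioc 0 T))
    (hx : ∀ t ∈ Icc 0 T, x t = x 0 + ∫ s in (0 : ℝ)..t, g s)
    (hφ : IntegrableOn φ (Ioc 0 T)) (hφ0 : ∀ s, 0 ≤ φ s)
    (hD : IntegrableOn D (Ioc 0 T)) (hD0 : ∀ s, 0 ≤ D s)
    (h : ∀ᵐ s ∂(volume.restrict (Ioc 0 T)), ⟪x s, g s⟫ ≤ φ s * ‖x s‖ - D s)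
    {t : ℝ} (ht : t ∈ Icc 0 T) :
    1 / 2 * ‖x t‖ ^ 2 + ∫ s in (0 : ℝ)..t, D s
      ≤ ‖x 0‖ ^ 2 + 3 / 2 * (∫ s in (0 : ℝ)..T, φ s) ^ 2 := by
  have hT : 0 ≤ T := ht.1.trans ht.2
  have h0 : (0 : ℝ) ∈ Icc 0 T := ⟨le_rfl, hT⟩
  have hTT : T ∈ Icc 0 T := ⟨hT, le_rfl⟩
  set Φ := ∫ s in (0 : ℝ)..T, φ s
  have hΦ : ∀ s ∈ Icc 0 T, ∫ r in (0 : ℝ)..s, φ r ≤ Φ := fun s hs =>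
    intervalIntegral.integral_mono_interval le_rfl hs.1 hs.2
      (Filter.Eventually.of_forall hφ0) (intervalIntegrable_of_integrableOn_Ioc hφ h0 hTT)
  have hΦ0 : 0 ≤ Φ := intervalIntegral.integral_nonneg hT fun s _ => hφ0 s
  set U := ‖x 0‖ + Φ
  have hU : ∀ s ∈ Icc 0 T, ‖x s‖ ≤ U := fun s hs => by
    have := norm_primitive_le hg hx hφ hφ0
      (h.mono fun s hs => hs.trans (by linarith [hD0 s])) hs
    linarith [hΦ s hs]
  have hxc : ContinuousOn x (Icc 0 T) := by
    have := (absolutelyContinuousOnInterval_primitive hg hx hTT).continuousOn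
    rwa [uIcc_of_le hT] at this
  have hint : IntegrableOn (fun s => 2 * ⟪x s, g s⟫) (Ioc 0 T) := by
    refine Integrable.const_mul ?_ 2
    refine Integrable.mono' (hg.norm.const_mul U)
      (((hxc.mono Ioc_subset_Icc_self).aestronglyMeasurable measurableSet_Ioc).inner
        hg.aestronglyMeasurable) ?_
    filter_upwards [self_mem_ae_restrict measurableSet_Ioc] with s hs
    exact (norm_inner_le_norm _ _).trans (by gcongr; exact hU s (Ioc_subset_Icc_self hs))
  have hid := norm_sq_primitive hg hx ht
  have hmono : ∫ s in (0 : ℝ)..t, 2 * ⟪x s, g s⟫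
      ≤ ∫ s in (0 : ℝ)..t, (2 * U * φ s - 2 * D s) := by
    refine intervalIntegral.integral_mono_ae_restrict ht.1
      (intervalIntegrable_of_integrableOn_Ioc hint h0 ht)
      (((intervalIntegrable_of_integrableOn_Ioc hφ h0 ht).const_mul _).sub
        ((intervalIntegrable_of_integrableOn_Ioc hD h0 ht).const_mul _)) ?_
    rw [← restrict_Ioc_eq_restrict_Icc]
    have h' := ae_restrict_of_ae_restrict_of_subset (Ioc_subset_Ioc_right ht.2) h
    filter_upwards [h', self_mem_ae_restrict measurableSet_Ioc] with s hs hst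
    have h1 := mul_le_mul_of_nonneg_left (hU s ⟨hst.1.le, hst.2.trans ht.2⟩) (hφ0 s)
    linarith
  rw [intervalIntegral.integral_sub
    ((intervalIntegrable_of_integrableOn_Ioc hφ h0 ht).const_mul _)
    ((intervalIntegrable_of_integrableOn_Ioc hD h0 ht).const_mul _)] at hmono
  simp only [intervalIntegral.integral_const_mul] at hid hmono
  have hU0 : 0 ≤ U := by positivity
  -- `‖x t‖² / 2 + ∫ D ≤ ‖x 0‖² / 2 + U Φ`, and `‖x 0‖ Φ ≤ (‖x 0‖² + Φ²) / 2`.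
  have h2 : U * (∫ s in (0 : ℝ)..t, φ s) ≤ U * Φ := mul_le_mul_of_nonneg_left (hΦ t ht) hU0
  have h3 : U * Φ = ‖x 0‖ * Φ + Φ ^ 2 := by simp only [U]; ring
  nlinarith [sq_nonneg (‖x 0‖ - Φ)]

theorem bilin_sum_sum {V : Type*} [AddCommGroup V] [Module ℝ V] {n : ℕ}
    (B : V →ₗ[ℝ] V →ₗ[ℝ] ℝ) (ξ : Fin n → ℝ) (e : Fin n → V) :
    B (∑ i, ξ i • e i) (∑ j, ξ j • e j) = ∑ i, ∑ j, ξ i * (ξ j * B (e i) (e j)) := by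
  simp only [map_sum, map_smul, LinearMap.sum_apply, LinearMap.smul_apply, smul_eq_mul,
    Finset.mul_sum]
  rw [Finset.sum_comm]
  exact Finset.sum_congr rfl fun i _ => Finset.sum_congr rfl fun j _ => by ring

section SemiDiscrete

variable {d : ℕ} {M : Mesh d}

theorem energySq_nonneg (hd : 0 < d) {κ σ : ℝ} (hκ : 0 < κ) (hσ : 0 ≤ σ) {N : ℕ}
    {hF : M.facets → ℝ} (hreg : ShapeRegular M κ N hF) (v : BrokenField M) :
    0 ≤ energySq M σ hF v := by
  refine add_nonneg (Finset.sum_nonneg fun K _ => integral_nonneg fun x =>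
    Finset.sum_nonneg fun i _ => Finset.sum_nonneg fun j _ => sq_nonneg _)
    (Finset.sum_nonneg fun F _ => mul_nonneg (div_nonneg hσ (hreg.facet_pos hd hκ F).le)
      (integral_nonneg fun x => sq_nonneg _))

theorem upwSq_nonneg {γ : ℝ} (hγ : 0 ≤ γ) (bn : M.facets → Vec d → ℝ) (v : BrokenField M) :
    0 ≤ upwSq M γ bn v :=
  Finset.sum_nonneg fun F _ => integral_nonneg fun x => by positivity

variable {T : ℝ} {β : ℝ → Vec d → Vec d} {βn : ℝ → M.facets → Vec d → ℝ}

/-- The dissipation along a curve with continuous coordinates is integrable. -/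
theorem IsConvectiveField.integrableOn_dissipation (h : IsConvectiveField M T β βn)
    (γ σ c : ℝ) (hF : M.facets → ℝ) {n : ℕ} (e : Fin n → BrokenField M) {ξ : ℝ → Fin n → ℝ}
    (hξ : Continuous ξ) :
    IntegrableOn (fun s => c * energySq M σ hF (∑ i, ξ s i • e i)
      + upwSq M γ (βn s) (∑ i, ξ s i • e i)) (Ioc 0 T) := by
  classical
  have hξi : ∀ i, MemLp (fun s => ξ s i) ∞ (volume.restrict (Ioc 0 T)) := by
    intro i
    have hc : Continuous fun s => ξ s i := (continuous_apply i).comp hξ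
    obtain ⟨B, hB⟩ := (isCompact_Icc (a := (0 : ℝ)) (b := T)).exists_bound_of_continuousOn
      hc.continuousOn
    refine memLp_top_of_bound hc.aestronglyMeasurable B ?_
    filter_upwards [self_mem_ae_restrict measurableSet_Ioc] with t ht
    exact hB t (Ioc_subset_Icc_self ht)
  have hmul : ∀ {f g : ℝ → ℝ}, MemLp f ∞ (volume.restrict (Ioc 0 T)) →
      MemLp g ∞ (volume.restrict (Ioc 0 T)) →
      MemLp (fun s => f s * g s) ∞ (volume.restrict (Ioc 0 T)) :=
    fun hf hg => hg.mul hf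
  have hgood := h.ae_isBoundedVelocity
  have hsum : ∀ a : Fin n → Fin n → ℝ → ℝ,
      (∀ i j, MemLp (a i j) ∞ (volume.restrict (Ioc 0 T))) →
      MemLp (fun s => ∑ i, ∑ j, ξ s i * (ξ s j * a i j s)) ∞ (volume.restrict (Ioc 0 T)) :=
    fun a ha => memLp_finsetSum _ fun i _ => memLp_finsetSum _ fun j _ =>
      hmul (hξi i) (hmul (hξi j) (ha i j))
  have hE := (hsum (fun i j _ => (gradForm M + penaltyForm M σ hF) (e i) (e j))
    fun i j => memLp_top_const _).const_mul c
  have hU := hsum _ fun i j => h.memLp_upw γ (e i) (e j)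
  refine ((hE.add hU).integrable le_top).congr ?_
  filter_upwards [hgood] with s hs
  rw [energySq_eq, upwSq_eq γ hs, ← LinearMap.add_apply, ← LinearMap.add_apply,
    bilin_sum_sum, bilin_sum_sum]
  simp only [upwForm_apply]
  rfl

/-- The Galerkin approximation of the evolution problem, its dissipation, and the energy
estimate. -/
theorem exists_solution_energy (hd : 0 < d) {m N : ℕ} {κ σ C γ ν : ℝ} (hκ : 0 < κ) (hσ : 0 ≤ σ)
    (hC : 0 ≤ C) (hγ : 0 ≤ γ) (hν : 0 < ν) (hT : 0 < T) {hF : M.facets → ℝ}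
    (hreg : ShapeRegular M κ N hF)
    {Vloc : M.elems → Submodule ℝ (PolyField d)}
    {Qloc : M.elems → Submodule ℝ (MvPolynomial (Fin d) ℝ)}
    (hV : ∀ K, ∀ v ∈ Vloc K, ∀ i, (v i).totalDegree ≤ m)
    (hQ : ∀ K, ∀ q ∈ Qloc K, q.totalDegree ≤ m)
    (hcoer : ∀ v ∈ Vh M Vloc, C * energySq M σ hF v ≤ aForm M σ hF v v)
    (hβ : IsConvectiveField M T β βn) (f : ℝ → L2Vec M)
    (hf : MemLp f 1 (volume.restrict (Ioc 0 T))) {u₀ : BrokenField M}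
    (hu₀ : u₀ ∈ VhDiv M Vloc Qloc) :
    ∃ (u : ℝ → BrokenField M) (p : ℝ → BrokenScalar M),
      (∀ r : ℝ≥0∞, MemLp f r (volume.restrict (Ioc 0 T)) →
        IsSolution M Vloc Qloc hF σ γ ν T β βn f u₀ r u p) ∧
      IntegrableOn (fun s => ν * C * energySq M σ hF (u s) + upwSq M γ (βn s) (u s)) (Ioc 0 T) ∧
      ∀ t ∈ Icc 0 T, 1 / 2 * ‖toL2 M (u t)‖ ^ 2
        + (∫ s in (0 : ℝ)..t, (ν * C * energySq M σ hF (u s) + upwSq M γ (βn s) (u s)))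
        ≤ ‖toL2 M u₀‖ ^ 2 + 3 / 2 * (∫ s in (0 : ℝ)..T, ‖f s‖) ^ 2 := by
  classical
  have hVfin := finiteDimensional_velocitySpace hV
  have hQfin := finiteDimensional_pressureSpace hQ
  set V := velocitySpace M Vloc
  set Q := pressureSpace M Qloc
  -- At the null set of times where `β` is not bounded the form is replaced by zero.
  let cB : ℝ → BrokenField M →ₗ[ℝ] BrokenField M →ₗ[ℝ] ℝ := fun t =>
    if h : IsBoundedVelocity M (β t) (βn t) then cBilin γ h else 0
  have hcB : ∀ t, IsBoundedVelocity M (β t) (βn t) → ∀ w v,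
      cB t w v = cForm M γ (β t) (βn t) w v := fun t h w v => by
    simp only [cB, dif_pos h, cBilin_apply]
  let A : ℝ → V →ₗ[ℝ] V →ₗ[ℝ] ℝ := fun t =>
    (ν • aBilin M σ hF + cB t).compl₁₂ V.subtype V.subtype
  have hA : ∀ t (w v : V), A t w v = ν * aForm M σ hF w v + cB t w v := fun t w v => by
    rw [← aBilin_apply]; rfl
  let b : V →ₗ[ℝ] Q →ₗ[ℝ] ℝ := (bBilin M).compl₁₂ V.subtype Q.subtype
  have hb : ∀ (w : V) (q : Q), b w q = bForm M w q := fun w q => by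
    rw [← bBilin_apply]; rfl
  have hgood := hβ.ae_isBoundedVelocity
  have hAmem : ∀ w v : V, MemLp (fun t => A t w v) ∞ (volume.restrict (Ioc 0 T)) := by
    intro w v
    refine MemLp.ae_eq ?_ ((memLp_top_const (ν * aForm M σ hF w v)).add (hβ.memLp_cForm γ w v))
    filter_upwards [hgood] with t ht
    rw [Pi.add_apply, hA, hcB t ht]
  obtain ⟨n, e, ξ, u, u', p, hξ, hue, hu0, hub, hint, heq, hr⟩ := exists_galerkin_solution
    ((toL2Lin M).comp V.subtype) ((toL2Lin_injective M).comp V.injective_subtype)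
    ((toL2sLin M).comp Q.subtype) b hT.le A (fun w v => (hAmem w v).aestronglyMeasurable)
    (fun w v => by
      obtain ⟨B, -, hB⟩ := ae_norm_le_of_memLp_top (hAmem w v)
      exact ⟨B, hB⟩) f hf ⟨u₀, hu₀.1⟩
    (LinearMap.ext fun q => by rw [hb]; exact hu₀.2 q q.2)
  have hint' : ∀ t ∈ Icc 0 T, toL2 M (u t) = toL2 M (u 0) + ∫ s in (0 : ℝ)..t, toL2 M (u' s) := hint
  have hue' : ∀ t, (u t : BrokenField M) = ∑ i, ξ t i • (e i : BrokenField M) := fun t => by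
    rw [hue, Submodule.coe_sum]; rfl
  have hD : IntegrableOn (fun s => ν * C * energySq M σ hF (u s) + upwSq M γ (βn s) (u s))
      (Ioc 0 T) := by
    simp only [hue']
    exact hβ.integrableOn_dissipation γ σ (ν * C) hF (fun i => (e i : BrokenField M)) hξ
  refine ⟨fun t => u t, fun t => p t, fun r hfr => ?_, hD, fun t ht => ?_⟩
  · obtain ⟨h1, h2, h3⟩ := hr r hfr
    refine ⟨congrArg Subtype.val hu0, fun t _ => (u t).2, h1,
      Filter.Eventually.of_forall fun t => (p t).2, h3, fun t => u' t,
      Filter.Eventually.of_forall fun t => (u' t).2, h2, hint', ?_⟩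
    filter_upwards [hgood] with t ht v hv q hq
    have h4 := heq t ⟨v, hv⟩ ⟨q, hq⟩
    rw [hA, hb, hb, hcB t ht] at h4
    simp only [LinearMap.comp_apply, Submodule.subtype_apply, toL2_apply] at h4
    linarith
  · have h1 := (hr 1 hf).2.1
    have hu0' : toL2 M u₀ = toL2 M (u 0) := by rw [hu0]
    rw [hu0']
    refine energy_estimate (x := fun t => toL2 M (u t)) (g := fun t => toL2 M (u' t))
      (memLp_one_iff_integrable.1 h1) hint'
      (memLp_one_iff_integrable.1 hf).norm (fun s => norm_nonneg _) hD
      (fun s => add_nonneg (mul_nonneg (mul_nonneg hν.le hC) (energySq_nonneg hd hκ hσ hreg _))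
        (upwSq_nonneg hγ _ _)) ?_ ht
    filter_upwards [hgood, hβ.2.2] with s hs hs'
    have h4 := heq s (u s) 0
    rw [hA, hub, hcB s hs, cForm_self γ hs hs'.2.1 hs'.2.2] at h4
    simp only [LinearMap.zero_apply, add_zero, sub_zero, LinearMap.comp_apply,
      Submodule.subtype_apply, toL2_apply] at h4
    have h5 := mul_le_mul_of_nonneg_left (hcoer (u s) (u s).2) hν.le
    have h6 := real_inner_le_norm (f s) (toL2 M (u s))
    rw [real_inner_comm]
    linarith

/-- The velocity is unique: the difference of two solutions is a discretely divergence-free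
solution for zero data, and its energy does not grow. -/
theorem IsSolution.velocity_unique (hd : 0 < d) {N : ℕ} {κ σ C γ ν : ℝ} (hκ : 0 < κ) (hσ : 0 ≤ σ)
    (hC : 0 ≤ C) (hγ : 0 ≤ γ) (hν : 0 < ν) {hF : M.facets → ℝ}
    (hreg : ShapeRegular M κ N hF)
    {Vloc : M.elems → Submodule ℝ (PolyField d)}
    {Qloc : M.elems → Submodule ℝ (MvPolynomial (Fin d) ℝ)}
    (hcoer : ∀ v ∈ Vh M Vloc, C * energySq M σ hF v ≤ aForm M σ hF v v)
    (hβ : IsConvectiveField M T β βn) {f : ℝ → L2Vec M} {u₀ : BrokenField M}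
    {u₁ u₂ : ℝ → BrokenField M} {p₁ p₂ : ℝ → BrokenScalar M}
    (h₁ : IsSolution M Vloc Qloc hF σ γ ν T β βn f u₀ 1 u₁ p₁)
    (h₂ : IsSolution M Vloc Qloc hF σ γ ν T β βn f u₀ 1 u₂ p₂) {t : ℝ} (ht : t ∈ Icc 0 T) :
    u₁ t = u₂ t := by
  obtain ⟨h10, h1V, -, h1p, -, u₁', -, h1m, h1i, h1e⟩ := h₁
  obtain ⟨h20, h2V, -, h2p, -, u₂', -, h2m, h2i, h2e⟩ := h₂
  have hT : 0 ≤ T := ht.1.trans ht.2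
  have h0 : (0 : ℝ) ∈ Icc 0 T := ⟨le_rfl, hT⟩
  have hg1 : IntegrableOn (fun s => toL2 M (u₁' s)) (Ioc 0 T) := memLp_one_iff_integrable.1 h1m
  have hg2 : IntegrableOn (fun s => toL2 M (u₂' s)) (Ioc 0 T) := memLp_one_iff_integrable.1 h2m
  let x : ℝ → L2Vec M := fun s => toL2Lin M (u₁ s - u₂ s)
  let g : ℝ → L2Vec M := fun s => toL2 M (u₁' s) - toL2 M (u₂' s)
  have hxs : ∀ s, x s = toL2 M (u₁ s) - toL2 M (u₂ s) := fun s => map_sub _ _ _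
  have hx : ∀ s ∈ Icc 0 T, x s = x 0 + ∫ r in (0 : ℝ)..s, g r := by
    intro s hs
    rw [hxs, hxs, h1i s hs, h2i s hs, intervalIntegral.integral_sub
      (intervalIntegrable_of_integrableOn_Ioc hg1 h0 hs)
      (intervalIntegrable_of_integrableOn_Ioc hg2 h0 hs)]
    abel
  have hx0 : x 0 = 0 := by rw [hxs, h10, h20, sub_self]
  have hle : ∀ᵐ s ∂(volume.restrict (Ioc 0 T)), ⟪x s, g s⟫ ≤ (0 : ℝ → ℝ) s * ‖x s‖ := by
    filter_upwards [h1p, h2p, h1e, h2e, hβ.ae_isBoundedVelocity, hβ.2.2,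
      self_mem_ae_restrict measurableSet_Ioc] with s hp1 hp2 he1 he2 hs hs' hsT
    have hsI := Ioc_subset_Icc_self hsT
    set w := u₁ s - u₂ s
    have hw : w ∈ Vh M Vloc := (velocitySpace M Vloc).sub_mem (h1V s hsI) (h2V s hsI)
    have hz : (0 : BrokenField M) ∈ Vh M Vloc := (velocitySpace M Vloc).zero_mem
    have hzq : (0 : BrokenScalar M) ∈ Qh M Qloc := (pressureSpace M Qloc).zero_mem
    simp only [← aBilin_apply, ← cBilin_apply γ hs, ← bBilin_apply, ← toL2_apply] at he1 he2
    -- Testing with `v = 0` shows that both velocities satisfy the constraint.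
    have hb1 : ∀ q ∈ Qh M Qloc, bBilin M (u₁ s) q = 0 := fun q hq => by
      simpa using he1 0 hz q hq
    have hb2 : ∀ q ∈ Qh M Qloc, bBilin M (u₂ s) q = 0 := fun q hq => by
      simpa using he2 0 hz q hq
    have hbw : ∀ q ∈ Qh M Qloc, bBilin M w q = 0 := fun q hq => by
      rw [map_sub, LinearMap.sub_apply, hb1 q hq, hb2 q hq, sub_zero]
    have e1 := he1 w hw 0 hzq
    have e2 := he2 w hw 0 hzq
    rw [hbw _ hp1, map_zero] at e1
    rw [hbw _ hp2, map_zero] at e2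
    have e3 : aBilin M σ hF w w = aBilin M σ hF (u₁ s) w - aBilin M σ hF (u₂ s) w := by
      rw [← LinearMap.sub_apply, ← map_sub]
    have e4 : cBilin γ hs w w = cBilin γ hs (u₁ s) w - cBilin γ hs (u₂ s) w := by
      rw [← LinearMap.sub_apply, ← map_sub]
    have e5 : ⟪x s, g s⟫ = ⟪toL2Lin M (u₁' s), toL2Lin M w⟫ - ⟪toL2Lin M (u₂' s), toL2Lin M w⟫ := by
      rw [real_inner_comm, ← inner_sub_left]; rfl
    rw [aBilin_apply] at e3
    rw [cBilin_apply, cForm_self γ hs hs'.2.1 hs'.2.2] at e4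
    have e6 := hcoer w hw
    have e7 : 0 ≤ aForm M σ hF w w :=
      (mul_nonneg hC (energySq_nonneg hd hκ hσ hreg w)).trans e6
    have e8 := upwSq_nonneg hγ (βn s) w
    have e9 : 0 ≤ ν * aForm M σ hF w w := mul_nonneg hν.le e7
    rw [e3, mul_sub] at e9
    rw [Pi.zero_apply, zero_mul, e5]
    linarith
  have hfin := norm_primitive_le (φ := 0) (hg1.sub hg2) hx (integrable_zero _ _ _)
    (fun s => le_rfl) hle ht
  rw [hx0] at hfin
  have hxt : toL2Lin M (u₁ t - u₂ t) = 0 := by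
    have : ‖x t‖ ≤ 0 := by simpa using hfin
    exact norm_le_zero_iff.1 this
  exact sub_eq_zero.1 ((injective_iff_map_eq_zero _).1 (toL2Lin_injective M) _ hxt)

end SemiDiscrete

end HdivFEM

theorem lemma2p11 (d : ℕ) (hd : d = 2 ∨ d = 3) (m N : ℕ) (κ : ℝ) (hκ : 0 < κ) :
    ∃ σ₀ : ℝ, 0 < σ₀ ∧ ∀ σ : ℝ, σ₀ ≤ σ → ∃ Cσ : ℝ, 0 < Cσ ∧
      ∀ (M : Mesh d) (hF : M.facets → ℝ), ShapeRegular M κ N hF →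
      ∀ (Vloc : M.elems → Submodule ℝ (PolyField d))
        (Qloc : M.elems → Submodule ℝ (MvPolynomial (Fin d) ℝ)),
        (∀ K, ∀ v ∈ Vloc K, ∀ i, (v i).totalDegree ≤ m) →
        (∀ K, ∀ q ∈ Qloc K, q.totalDegree ≤ m) →
        (∀ v ∈ Vh M Vloc, Cσ * energySq M σ hF v ≤ aForm M σ hF v v) ∧
        ∀ (γ ν T : ℝ), 0 ≤ γ → 0 < ν → 0 < T →
        ∀ (β : ℝ → Vec d → Vec d) (βn : ℝ → M.facets → Vec d → ℝ),
          IsConvectiveField M T β βn →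
        ∀ (f : ℝ → L2Vec M), MemLp f 1 (volume.restrict (Ioc 0 T)) →
        ∀ u₀ ∈ VhDiv M Vloc Qloc,
          (∃ (u : ℝ → BrokenField M) (p : ℝ → BrokenScalar M),
            IsSolution M Vloc Qloc hF σ γ ν T β βn f u₀ 1 u p ∧
            (MemLp f 2 (volume.restrict (Ioc 0 T)) →
              IsSolution M Vloc Qloc hF σ γ ν T β βn f u₀ 2 u p) ∧
            IntegrableOn (fun s => ν * Cσ * energySq M σ hF (u s) + upwSq M γ (βn s) (u s))
              (Ioc 0 T) ∧
            ∀ t ∈ Icc 0 T,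
              1 / 2 * ‖toL2 M (u t)‖ ^ 2
                + (∫ s in (0 : ℝ)..t,
                    (ν * Cσ * energySq M σ hF (u s) + upwSq M γ (βn s) (u s)))
              ≤ ‖toL2 M u₀‖ ^ 2 + 3 / 2 * (∫ s in (0 : ℝ)..T, ‖f s‖) ^ 2) ∧
          ((∃ L : NNReal, LipschitzOnWith L f (Ioc 0 T)) →
            ∀ (u₁ u₂ : ℝ → BrokenField M) (p₁ p₂ : ℝ → BrokenScalar M),
              IsSolution M Vloc Qloc hF σ γ ν T β βn f u₀ 1 u₁ p₁ →
              IsSolution M Vloc Qloc hF σ γ ν T β βn f u₀ 1 u₂ p₂ →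
              ∀ t ∈ Icc 0 T, u₁ t = u₂ t) := by
  have hd0 : 0 < d := by omega
  obtain ⟨σ₀, hσ₀, hcoer⟩ := exists_aForm_coercive hd0 m N hκ
  refine ⟨σ₀, hσ₀, fun σ hσ => ⟨1 / 2, by norm_num, fun M hF hreg Vloc Qloc hV hQ => ?_⟩⟩
  have hc : ∀ v ∈ Vh M Vloc, 1 / 2 * energySq M σ hF v ≤ aForm M σ hF v v := fun v hv =>
    hcoer σ hσ M hF hreg v fun K => hV K (v K) (hv.1 K)
  have hσ0 : 0 ≤ σ := hσ₀.le.trans hσ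
  refine ⟨hc, fun γ ν T hγ hν hT β βn hβ f hf u₀ hu₀ => ⟨?_, fun _ u₁ u₂ p₁ p₂ h₁ h₂ t ht =>
    h₁.velocity_unique hd0 hκ hσ0 (by norm_num) hγ hν hreg hc hβ h₂ ht⟩⟩
  obtain ⟨u, p, hsol, hint, hen⟩ := exists_solution_energy hd0 hκ hσ0 (by norm_num) hγ hν hT hreg
    hV hQ hc hβ f hf hu₀
  exact ⟨u, p, hsol 1 hf, hsol 2, hint, hen⟩
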